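/- Let $K$ be a (real, finite-dimensional) Lie group with Lie algebra $\mathfrak k$, and let $p:P\to M$ be a smooth principal $K$-bundle over a smooth (finite-dimensional, Hausdorff, boundaryless) manifold $M$, with $K$ acting on $P$ from the right. Let $A$ be a connection on $P$, that is, a smooth $K$-invariant distribution $A\subset T_P$ (the horizontal distribution) with $T_P=\ker p_*\oplus A$. Let $\omega_A$ be its connection form: the $\mathfrak k$-valued $1$-form on $P$ that vanishes on $A$ and satisfies $\omega_A(a^\#)=a$ for $a\in\mathfrak k$, where $a^\#_y=\frac{d}{dt}\big|_{t=0}\,y\exp(ta)$. For a tangent vector $v\in T_xM$ and $y\in p^{-1}(x)$, let $\tilde v\in A_y$ be the horizontal lift of $v$ to $y$. Let $\mathrm{ad}(P)=P\times_{\mathrm{Ad}}\mathfrak k$ be the adjoint bundle, that is, the quotient of $P\times\mathfrak k$ by $(y,a)\sim(yk,\mathrm{Ad}_{k^{-1}}a)$, with classes $[y,a]$. A smooth section $\nu$ of $\mathrm{ad}(P)$ is the same as a smooth map $\hat\nu:P\to\mathfrak k$ with $\hat\nu(yk)=\mathrm{Ad}_{k^{-1}}\hat\nu(y)$, through $\nu(p(y))=[y,\hat\nu(y)]$.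 For such a section, let $\xi^\nu$ be the vertical vector field $\xi^\nu_y=\frac{d}{dt}\big|_{t=0}\,y\exp(t\hat\nu(y))$ on $P$, and let $\nabla^A\nu$ be its covariant derivative, the $\mathrm{ad}(P)$-valued $1$-form on $M$ given by $(\nabla^A\nu)(v)=[y,d\hat\nu_y(\tilde v)]$ for $v\in T_xM$, $y\in p^{-1}(x)$. The curvature $F_A$ is the $\mathrm{ad}(P)$-valued $2$-form on $M$ given by $F_A(v,w)=[y,(d\omega_A)_y(\tilde v,\tilde w)]$ for $v,w\in T_xM$, $y\in p^{-1}(x)$, with the convention $d\omega(U,V)=U\omega(V)-V\omega(U)-\omega([U,V])$. (Both are independent of the choice of $y$.) Let $X$ be a smooth vector field on $M$ with horizontal lift $\tilde X$ to $P$, let $\nu$ be a smooth section of $\mathrm{ad}(P)$, and let $(\beta_t)$ be the local flow ($1$-parameter group of local diffeomorphisms) on $P$ generated by $\tilde X+\xi^\nu$. Then the connection $A$ is invariant under $(\beta_t)$, that is, $$(\beta_t)_*A_y=A_{\beta_t(y)}\quad\text{for all }(y,t)\in P\times\mathbb R\text{ for which }\beta_t(y)\text{ is defined},$$ if and only if $X$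 and $\nu$ satisfy the generalized moment map equation $$\iota_XF_A=-\nabla^A\nu .$$ -/

import Mathlib

open scoped Manifold ContDiff Topology RightActions

/-- A smooth principal `K`-bundle `proj : P → M` for a Lie group `K` acting on the right of `P`
(`y <• k` is the point `y` moved by `k`): the action is smooth, preserves the fibres, and the
bundle is locally trivial, by smooth trivialisations
`proj ⁻¹ U ≃ U × K` over `U` that are equivariant for right multiplication on `K`. -/
structure PrincipalBundle
    {EK HK : Type*} [NormedAddCommGroup EK] [NormedSpace ℝ EK] [TopologicalSpace HK]
    (IK : ModelWithCorners ℝ EK HK)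
    (K : Type*) [TopologicalSpace K] [ChartedSpace HK K] [Group K]
    {EM HM : Type*} [NormedAddCommGroup EM] [NormedSpace ℝ EM] [TopologicalSpace HM]
    (I : ModelWithCorners ℝ EM HM) (M : Type*) [TopologicalSpace M] [ChartedSpace HM M]
    {EP HP : Type*} [NormedAddCommGroup EP] [NormedSpace ℝ EP] [TopologicalSpace HP]
    (J : ModelWithCorners ℝ EP HP) (P : Type*) [TopologicalSpace P] [ChartedSpace HP P]
    [MulAction Kᵐᵒᵖ P] where
  /-- the bundle projection -/
  proj : P → M
  contMDiff_proj : ContMDiff J I ∞ proj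
  contMDiff_act : ContMDiff (J.prod IK) J ∞ (fun z : P × K => z.1 <• z.2)
  proj_act : ∀ (y : P) (k : K), proj (y <• k) = proj y
  locallyTrivial : ∀ x₀ : M, ∃ (U : Set M) (e : OpenPartialHomeomorph P (M × K)),
    IsOpen U ∧ x₀ ∈ U ∧
    e.source = proj ⁻¹' U ∧ e.target = U ×ˢ Set.univ ∧
    (∀ y ∈ e.source, (e y).1 = proj y) ∧
    (∀ y ∈ e.source, ∀ k : K, (e (y <• k)).2 = (e y).2 * k) ∧
    ContMDiffOn J (I.prod IK) ∞ e e.source ∧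
    ContMDiffOn (I.prod IK) J ∞ e.symm e.target

noncomputable section

section Flow

variable {EP HP : Type*} [NormedAddCommGroup EP] [NormedSpace ℝ EP] [TopologicalSpace HP]
  (J : ModelWithCorners ℝ EP HP) {P : Type*} [TopologicalSpace P] [ChartedSpace HP P]

/-- `γ` is an integral curve of the vector field `Y` starting at `y`, defined on some open interval
that contains `0` and `t`. -/
def IsFlowLine (Y : ∀ y : P, TangentSpace J y) (t : ℝ) (y : P) (γ : ℝ → P) : Prop :=
  γ 0 = y ∧ ∃ a b : ℝ, (0 : ℝ) ∈ Set.Ioo a b ∧ t ∈ Set.Ioo a b ∧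
    IsMIntegralCurveOn (I := J) γ Y (Set.Ioo a b)

/-- `β_t(y)` is defined, for the local flow `β` of the vector field `Y`. -/
def FlowDefined (Y : ∀ y : P, TangentSpace J y) (t : ℝ) (y : P) : Prop :=
  ∃ γ : ℝ → P, IsFlowLine J Y t y γ

open Classical in
/-- The local flow (1-parameter group of local diffeomorphisms) `β_t` generated by the vector
field `Y`, on its maximal domain of definition. Where `β_t(y)` is not defined, the value is
the junk value `y`. -/
def localFlow (Y : ∀ y : P, TangentSpace J y) (t : ℝ) (y : P) : P :=
  if h : FlowDefined J Y t y then h.choose t else y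

end Flow

section LieGroup

variable {EK HK : Type*} [NormedAddCommGroup EK] [NormedSpace ℝ EK] [TopologicalSpace HK]
  (IK : ModelWithCorners ℝ EK HK)
  {K : Type*} [TopologicalSpace K] [ChartedSpace HK K] [Group K]

/-- The adjoint representation of a Lie group on its Lie algebra `T_1 K`: the differential
at `1` of the conjugation `g ↦ k g k⁻¹`. -/
def adjointRep (k : K) (a : GroupLieAlgebra IK K) : GroupLieAlgebra IK K :=
  mfderiv IK IK (fun g : K => k * g * k⁻¹) 1 a

theorem adjointRep_neg (k : K) (a : GroupLieAlgebra IK K) :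
    adjointRep IK k (-a) = -adjointRep IK k a :=
  map_neg (mfderiv IK IK (fun g : K => k * g * k⁻¹) 1) a

theorem adjointRep_one (a : GroupLieAlgebra IK K) : adjointRep IK (1 : K) a = a := by
  have h : (fun g : K => (1 : K) * g * (1 : K)⁻¹) = id := by funext g; simp
  unfold adjointRep
  rw [h, mfderiv_id]
  rfl

variable [LieGroup IK ∞ K]

theorem contMDiff_conj (k : K) : ContMDiff IK IK ∞ (fun g : K => k * g * k⁻¹) :=
  (contMDiff_mul_right (a := k⁻¹)).comp (contMDiff_mul_left (a := k))

theorem adjointRep_mul (k l : K) (a : GroupLieAlgebra IK K) :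
    adjointRep IK (k * l) a = adjointRep IK k (adjointRep IK l a) := by
  have h : (fun g : K => (k * l) * g * (k * l)⁻¹)
      = (fun g : K => k * g * k⁻¹) ∘ (fun g : K => l * g * l⁻¹) := by
    funext g; simp [mul_assoc]
  have h1 : l * 1 * l⁻¹ = 1 := by simp
  have hd : ∀ (m g : K), MDifferentiableAt IK IK (fun g : K => m * g * m⁻¹) g :=
    fun m g => (contMDiff_conj IK m).mdifferentiable (by simp) g
  unfold adjointRep
  rw [h, mfderiv_comp (I' := IK) (1 : K) (hd k _) (hd l _)]
  have h3 : ∀ (p q : K) (hp : p = q) (u : EK),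
      ((mfderiv IK IK (fun g : K => k * g * k⁻¹) p : EK →L[ℝ] EK) u)
        = ((mfderiv IK IK (fun g : K => k * g * k⁻¹) q : EK →L[ℝ] EK) u) := by
    rintro p q rfl u; rfl
  exact h3 _ _ h1 _

end LieGroup

namespace PrincipalBundle

variable {EK HK : Type*} [NormedAddCommGroup EK] [NormedSpace ℝ EK] [TopologicalSpace HK]
  {IK : ModelWithCorners ℝ EK HK}
  {K : Type*} [TopologicalSpace K] [ChartedSpace HK K] [Group K]
  {EM HM : Type*} [NormedAddCommGroup EM] [NormedSpace ℝ EM] [TopologicalSpace HM]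
  {I : ModelWithCorners ℝ EM HM} {M : Type*} [TopologicalSpace M] [ChartedSpace HM M]
  {EP HP : Type*} [NormedAddCommGroup EP] [NormedSpace ℝ EP] [TopologicalSpace HP]
  {J : ModelWithCorners ℝ EP HP} {P : Type*} [TopologicalSpace P] [ChartedSpace HP P]
  [MulAction Kᵐᵒᵖ P] (B : PrincipalBundle IK K I M J P)

/-! ### Elementary facts on the action -/

theorem exists_act_eq {y y' : P} (h : B.proj y = B.proj y') : ∃ k : K, y' = y <• k := by
  obtain ⟨U, e, -, hxU, hsrc, -, hfst, hsnd, -, -⟩ := B.locallyTrivial (B.proj y)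
  have hmem : ∀ z, B.proj z = B.proj y → z ∈ e.source := fun z hz => by
    rw [hsrc]; show B.proj z ∈ U; rw [hz]; exact hxU
  have hy := hmem y rfl
  refine ⟨(e y).2⁻¹ * (e y').2, e.injOn (hmem y' h.symm) (hmem _ (B.proj_act _ _)) ?_⟩
  refine Prod.ext ?_ ?_
  · rw [hfst _ (hmem y' h.symm), hfst _ (hmem _ (B.proj_act _ _)), B.proj_act, h]
  · rw [hsnd y hy]; simp

theorem act_injective (B : PrincipalBundle IK K I M J P) (y : P) : Function.Injective (fun k : K => y <• k) := by
  intro k l hkl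
  obtain ⟨U, e, -, hxU, hsrc, -, -, hsnd, -, -⟩ := B.locallyTrivial (B.proj y)
  have hy : y ∈ e.source := by rw [hsrc]; exact hxU
  have := congrArg (fun z => (e z).2) hkl
  simp only [hsnd y hy] at this
  exact mul_left_cancel this

theorem proj_surjective : Function.Surjective B.proj := by
  intro x
  obtain ⟨U, e, -, hxU, hsrc, htgt, hfst, -, -, -⟩ := B.locallyTrivial x
  have hx : ((x, 1) : M × K) ∈ e.target := by rw [htgt]; exact ⟨hxU, trivial⟩
  refine ⟨e.symm (x, 1), ?_⟩
  rw [← hfst _ (e.map_target hx), e.right_inv hx]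

/-- Some point of `P` in the fibre over `x`. -/
def point (x : M) : P := (B.proj_surjective x).choose

theorem proj_point (x : M) : B.proj (B.point x) = x := (B.proj_surjective x).choose_spec

theorem mfderiv_proj_surjective (y : P) : Function.Surjective (mfderiv J I B.proj y) := by
  obtain ⟨U, e, hU, hxU, hsrc, htgt, hfst, -, -, hsymm⟩ := B.locallyTrivial (B.proj y)
  have hy : y ∈ e.source := by rw [hsrc]; exact hxU
  have hey : e y = (B.proj y, (e y).2) := Prod.ext (hfst y hy) rfl
  have hmem : ((B.proj y, (e y).2) : M × K) ∈ e.target := hey ▸ e.map_source hy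
  have hback : e.symm (B.proj y, (e y).2) = y := by rw [← hey, e.left_inv hy]
  have hs : MDifferentiableAt I J (fun x => e.symm (x, (e y).2)) (B.proj y) := by
    have h1 : ContMDiffAt (I.prod IK) J ∞ e.symm (B.proj y, (e y).2) :=
      hsymm.contMDiffAt (e.open_target.mem_nhds hmem)
    have h2 : ContMDiffAt I (I.prod IK) ∞ (fun x : M => (x, (e y).2)) (B.proj y) :=
      contMDiffAt_id.prodMk contMDiffAt_const
    exact (ContMDiffAt.comp (B.proj y) h1 h2).mdifferentiableAt (by simp)
  have hp : ∀ z, MDifferentiableAt J I B.proj z := B.contMDiff_proj.mdifferentiable (by simp)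
  have hcomp : (B.proj ∘ fun x => e.symm (x, (e y).2)) =ᶠ[𝓝 (B.proj y)] id := by
    filter_upwards [hU.mem_nhds hxU] with x hx
    have hx' : ((x, (e y).2) : M × K) ∈ e.target := by rw [htgt]; exact ⟨hx, trivial⟩
    show B.proj (e.symm (x, (e y).2)) = x
    rw [← hfst _ (e.map_target hx'), e.right_inv hx']
  have hd := mfderiv_comp (I' := J) (B.proj y) (hp _) hs
  rw [hcomp.mfderiv_eq, mfderiv_id] at hd
  intro v
  have key : ∀ z : P, z = y → ∀ (L : EM →L[ℝ] EP),
      (ContinuousLinearMap.id ℝ EM = (mfderiv J I B.proj z : EP →L[ℝ] EM).comp L) →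
      ∃ u : EP, (mfderiv J I B.proj y : EP →L[ℝ] EM) u = v := by
    rintro z rfl L hL
    exact ⟨L v, (congrArg (fun T : EM →L[ℝ] EM => T v) hL).symm⟩
  exact key _ hback _ hd

/-! ### Fundamental and vertical fields -/

/-- The fundamental vector field `a^#` of `a` in the Lie algebra: `a^#_y = d/dt|₀ (y exp(ta))`, that
is, the image of `a` under the differential at `1` of the orbit map `k ↦ y k`. -/
def fundamentalMap (_B : PrincipalBundle IK K I M J P) (y : P) :
    GroupLieAlgebra IK K →L[ℝ] TangentSpace J y :=
  (mfderiv IK J (fun k : K => y <• k) 1 : EK →L[ℝ] EP)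

theorem mdifferentiableAt_act (B : PrincipalBundle IK K I M J P) (y : P) (k : K) :
    MDifferentiableAt (J.prod IK) J (fun z : P × K => z.1 <• z.2) (y, k) :=
  B.contMDiff_act.mdifferentiable (by simp) _

theorem mdifferentiableAt_orbit (B : PrincipalBundle IK K I M J P) (y : P) (k : K) :
    MDifferentiableAt IK J (fun k : K => y <• k) k :=
  (B.mdifferentiableAt_act y k).comp k (mdifferentiableAt_const.prodMk mdifferentiableAt_id)

theorem proj_fundamentalMap (y : P) (a : GroupLieAlgebra IK K) :
    mfderiv J I B.proj y (B.fundamentalMap y a) = 0 := by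
  have hp : ∀ z, MDifferentiableAt J I B.proj z := B.contMDiff_proj.mdifferentiable (by simp)
  have hd := mfderiv_comp (I' := J) (1 : K) (hp _) (B.mdifferentiableAt_orbit y 1)
  have hc : (B.proj ∘ fun k : K => y <• k) = fun _ => B.proj y := by
    funext k; exact B.proj_act y k
  rw [hc, mfderiv_const] at hd
  have key : ∀ z : P, z = y →
      ((0 : EK →L[ℝ] EM) = (mfderiv J I B.proj z : EP →L[ℝ] EM).comp
        (mfderiv IK J (fun k : K => y <• k) 1 : EK →L[ℝ] EP)) →
      (mfderiv J I B.proj y : EP →L[ℝ] EM)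
        ((mfderiv IK J (fun k : K => y <• k) 1 : EK →L[ℝ] EP) a) = 0 := by
    rintro z rfl h
    exact (congrArg (fun T : EK →L[ℝ] EM => T a) h).symm
  exact key (y <• (1 : K)) (by simp) hd

section Vertical

variable [LieGroup IK ∞ K]

/-- There are a local section `s` through `y`, and a map `q` to `K`, defined near `y`, that gives the
position in the fibres relative to `s`. -/
theorem exists_section (y : P) : ∃ (s : M → P) (q : P → K),
    MDifferentiableAt I J s (B.proj y) ∧ MDifferentiableAt J IK q y ∧
    s (B.proj y) = y ∧ (∀ k : K, q (y <• k) = k) ∧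
    (fun z => s (B.proj z) <• q z) =ᶠ[𝓝 y] id := by
  obtain ⟨U, e, hU, hxU, hsrc, htgt, hfst, hsnd, hsm, hsymm⟩ := B.locallyTrivial (B.proj y)
  have hy : y ∈ e.source := by rw [hsrc]; exact hxU
  have hey : e y = (B.proj y, (e y).2) := Prod.ext (hfst y hy) rfl
  have hmem : ((B.proj y, (e y).2) : M × K) ∈ e.target := hey ▸ e.map_source hy
  refine ⟨fun x => e.symm (x, (e y).2), fun z => (e y).2⁻¹ * (e z).2, ?_, ?_, ?_, ?_, ?_⟩
  · have h1 : ContMDiffAt (I.prod IK) J ∞ e.symm (B.proj y, (e y).2) :=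
      hsymm.contMDiffAt (e.open_target.mem_nhds hmem)
    have h2 : ContMDiffAt I (I.prod IK) ∞ (fun x : M => (x, (e y).2)) (B.proj y) :=
      contMDiffAt_id.prodMk contMDiffAt_const
    exact (ContMDiffAt.comp (B.proj y) h1 h2).mdifferentiableAt (by simp)
  · have h1 : ContMDiffAt J (I.prod IK) ∞ e y := hsm.contMDiffAt (e.open_source.mem_nhds hy)
    have h2 : ContMDiffAt J IK ∞ (fun z => (e z).2) y := contMDiffAt_snd.comp y h1
    have h3 : ContMDiff IK IK ∞ (fun g : K => (e y).2⁻¹ * g) := contMDiff_mul_left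
    exact (ContMDiffAt.comp y h3.contMDiffAt h2).mdifferentiableAt (by simp)
  · show e.symm (B.proj y, (e y).2) = y
    rw [← hey, e.left_inv hy]
  · intro k
    show (e y).2⁻¹ * (e (y <• k)).2 = k
    rw [hsnd y hy]; simp
  · filter_upwards [e.open_source.mem_nhds hy] with z hz
    have hzU : B.proj z ∈ U := by rw [hsrc] at hz; exact hz
    have hz' : ((B.proj z, (e y).2) : M × K) ∈ e.target := by rw [htgt]; exact ⟨hzU, trivial⟩
    have hs := e.map_target hz'
    have hps : B.proj (e.symm (B.proj z, (e y).2)) = B.proj z := by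
      rw [← hfst _ hs, e.right_inv hz']
    have ha : e.symm (B.proj z, (e y).2) <• ((e y).2⁻¹ * (e z).2) ∈ e.source := by
      rw [hsrc]; show B.proj _ ∈ U; rw [B.proj_act, hps]; exact hzU
    refine e.injOn ha hz (Prod.ext ?_ ?_)
    · rw [hfst _ ha, B.proj_act, hps]; exact (hfst _ hz).symm
    · rw [hsnd _ hs, e.right_inv hz']; exact mul_inv_cancel_left _ _

theorem fundamentalMap_injective (y : P) : Function.Injective (B.fundamentalMap y) := by
  obtain ⟨s, q, -, hq, -, hqk, -⟩ := B.exists_section y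
  have hq' : MDifferentiableAt J IK q (y <• (1 : K)) := by simpa using hq
  have hd := mfderiv_comp (I' := J) (1 : K) hq' (B.mdifferentiableAt_orbit y 1)
  have hc : (q ∘ fun k : K => y <• k) = id := by funext k; exact hqk k
  rw [hc, mfderiv_id] at hd
  intro a b hab
  have h : ∀ c : EK, c = (mfderiv J IK q (y <• (1 : K)) : EP →L[ℝ] EK)
      ((mfderiv IK J (fun k : K => y <• k) 1 : EK →L[ℝ] EP) c) := fun c =>
    congrArg (fun T : EK →L[ℝ] EK => T c) hd
  have hab' : (mfderiv IK J (fun k : K => y <• k) 1 : EK →L[ℝ] EP) a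
      = (mfderiv IK J (fun k : K => y <• k) 1 : EK →L[ℝ] EP) b := hab
  exact (h a).trans ((congrArg _ hab').trans (h b).symm)

theorem exists_fundamentalMap_eq (y : P) (u : TangentSpace J y)
    (hu : mfderiv J I B.proj y u = 0) : ∃ a, B.fundamentalMap y a = u := by
  obtain ⟨s, q, hs, hq, hsy, hqk, hid⟩ := B.exists_section y
  have hp : MDifferentiableAt J I B.proj y := B.contMDiff_proj.mdifferentiable (by simp) y
  have hsp := mfderiv_comp (I' := I) y hs hp
  have hsp0 : mfderiv J J (s ∘ B.proj) y u = 0 := by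
    rw [hsp]
    exact (congrArg (mfderiv I J s (B.proj y)) hu).trans (map_zero _)
  have hpair : MDifferentiableAt J (J.prod IK) (fun z => ((s ∘ B.proj) z, q z)) y :=
    (hs.comp y hp).prodMk hq
  have hact := B.mdifferentiableAt_act (s (B.proj y)) (q y)
  have hd := mfderiv_comp (I' := J.prod IK) y (g := fun z : P × K => z.1 <• z.2) hact hpair
  have hid' : ((fun z : P × K => z.1 <• z.2) ∘ fun z => ((s ∘ B.proj) z, q z)) =ᶠ[𝓝 y] id := hid
  rw [hid'.mfderiv_eq, mfderiv_id, mfderiv_prodMk (hs.comp y hp) hq] at hd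
  have hu1 := congrArg (fun T : EP →L[ℝ] EP => T u) hd
  let w : EP × EK := ((mfderiv J J (s ∘ B.proj) y : EP →L[ℝ] EP) u,
    (mfderiv J IK q y : EP →L[ℝ] EK) u)
  have hadd := mfderiv_prod_eq_add_apply (v := w) hact
  have hq1 : q y = 1 := by simpa using hqk 1
  refine ⟨(mfderiv J IK q y : EP →L[ℝ] EK) u, ?_⟩
  have key : ∀ (z : P) (k : K), z = y → k = 1 → ∀ a : EK,
      (mfderiv IK J (fun k : K => z <• k) k : EK →L[ℝ] EP) a
        = (mfderiv IK J (fun k : K => y <• k) 1 : EK →L[ℝ] EP) a := by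
    rintro z k rfl rfl a; rfl
  have h3 : (u : EP) = (mfderiv J J (fun z : P => z <• q y) (s (B.proj y)) : EP →L[ℝ] EP)
        ((mfderiv J J (s ∘ B.proj) y : EP →L[ℝ] EP) u)
      + (mfderiv IK J (fun k : K => s (B.proj y) <• k) (q y) : EK →L[ℝ] EP)
        ((mfderiv J IK q y : EP →L[ℝ] EK) u) := hu1.trans hadd
  have h0 : (mfderiv J J (fun z : P => z <• q y) (s (B.proj y)) : EP →L[ℝ] EP)
      ((mfderiv J J (s ∘ B.proj) y : EP →L[ℝ] EP) u) = (0 : EP) :=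
    (congrArg (mfderiv J J (fun z : P => z <• q y) (s (B.proj y)) : EP →L[ℝ] EP) hsp0).trans
      (map_zero _)
  have h4 := h3.trans ((congrArg (· + _) h0).trans (zero_add _))
  exact (key _ _ hsy hq1 _).symm.trans h4.symm

/-- The canonical isomorphism of the Lie algebra of `K` with the vertical space `ker (dp_y)`. -/
def verticalEquiv (y : P) :
    GroupLieAlgebra IK K ≃ₗ[ℝ] LinearMap.ker (mfderiv J I B.proj y).toLinearMap :=
  LinearEquiv.ofBijective
    ((B.fundamentalMap y).toLinearMap.codRestrict _ fun a => B.proj_fundamentalMap y a)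
    ⟨fun _ _ h => B.fundamentalMap_injective y (congrArg Subtype.val h), fun u =>
      (B.exists_fundamentalMap_eq y u.1 u.2).imp fun _ h => Subtype.ext h⟩

/-- The vertical vector field `ξ^ν` of a map `ν` from `P` to the Lie algebra:
`ξ^ν_y = d/dt|₀ (y exp(t ν(y)))`. -/
def verticalField (ν : P → GroupLieAlgebra IK K) (y : P) : TangentSpace J y :=
  B.fundamentalMap y (ν y)

end Vertical

/-! ### The adjoint bundle -/

section Adjoint

variable [LieGroup IK ∞ K]

/-- Two pairs `(y, a)`, `(y', a')` with `y`, `y'` in the fibre over `x` are identified in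
`ad(P) = P ×_Ad 𝔨` if `(y', a') = (y k, Ad(k⁻¹) a)` for some `k` in `K`. -/
def adSetoid (x : M) : Setoid ({y : P // B.proj y = x} × GroupLieAlgebra IK K) where
  r s t := ∃ k : K, t.1.1 = s.1.1 <• k ∧ t.2 = adjointRep IK k⁻¹ s.2
  iseqv :=
    { refl := fun s => ⟨1, by simp, by rw [inv_one, adjointRep_one]⟩
      symm := by
        rintro s t ⟨k, h1, h2⟩
        refine ⟨k⁻¹, by rw [h1]; simp, ?_⟩
        rw [h2, ← adjointRep_mul, inv_inv, mul_inv_cancel, adjointRep_one]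
      trans := by
        rintro s t u ⟨k, h1, h2⟩ ⟨l, h3, h4⟩
        refine ⟨k * l, by rw [h3, h1]; simp [mul_smul], ?_⟩
        rw [h4, h2, ← adjointRep_mul, mul_inv_rev] }

/-- The fibre over `x` of the adjoint bundle `ad(P) = P ×_Ad 𝔨`. -/
def AdFiber (x : M) : Type _ := Quotient (B.adSetoid x)

/-- The class `[y, a]` in the fibre of the adjoint bundle over `x = proj y`. -/
def adMk {x : M} (y : P) (hy : B.proj y = x) (a : GroupLieAlgebra IK K) : B.AdFiber x :=
  Quotient.mk (B.adSetoid x) (⟨y, hy⟩, a)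

/-- The negative in the vector space `ad(P)_x`: `-[y, a] = [y, -a]`. -/
instance (x : M) : Neg (B.AdFiber x) where
  neg := Quotient.map (sa := B.adSetoid x) (sb := B.adSetoid x) (fun s => (s.1, -s.2)) (by
    rintro s t ⟨k, h1, h2⟩
    exact ⟨k, h1, by rw [h2, adjointRep_neg]⟩)

theorem existsUnique_adMk {x : M} (c : B.AdFiber x) (y : P) (hy : B.proj y = x) :
    ∃! a, B.adMk y hy a = c := by
  obtain ⟨⟨⟨y', hy'⟩, a'⟩, rfl⟩ := Quotient.exists_rep c
  obtain ⟨k, hk⟩ := B.exists_act_eq (hy'.trans hy.symm)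
  have h : B.adMk y hy (adjointRep IK k⁻¹ a') = Quotient.mk (B.adSetoid x) (⟨y', hy'⟩, a') :=
    (Quotient.sound (s := B.adSetoid x) ⟨k, hk, rfl⟩).symm
  refine ⟨_, h, fun b hb => ?_⟩
  obtain ⟨l, hl1, hl2⟩ := Quotient.exact (s := B.adSetoid x) (h.trans hb.symm)
  have : l = 1 := B.act_injective y (by
    show y <• l = y <• (1 : K)
    have h1 : y = y <• l := hl1
    rw [← h1]; simp)
  subst this
  exact hl2.trans (by rw [inv_one, adjointRep_one])

/-- The `K`-equivariant map `P → 𝔨` of a (set-theoretic) section `ν` of the adjoint bundle: at `y`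
it is the unique `a` with `[y, a] = ν(proj y)`. -/
def equivariantMap (ν : ∀ x : M, B.AdFiber x) (y : P) : GroupLieAlgebra IK K :=
  (B.existsUnique_adMk (ν (B.proj y)) y rfl).choose

/-- The space `A⁰(ad(P))` of smooth sections of the adjoint bundle; a section is smooth if
the corresponding equivariant map `P → 𝔨` is smooth. -/
structure AdSection where
  toFun : ∀ x : M, B.AdFiber x
  contMDiff_equivariantMap : ContMDiff (M' := EK) J 𝓘(ℝ, EK) ∞ (B.equivariantMap toFun)

end Adjoint

/-! ### Connections -/

/-- A connection on the principal bundle: a smooth `K`-invariant distribution `hor` on `P` (the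
horizontal distribution) which is complementary to the vertical distribution. Smoothness means that
`hor` locally has a frame of smooth vector fields. -/
structure Connection [IsManifold J ∞ P] where
  hor : ∀ y : P, Submodule ℝ (TangentSpace J y)
  isCompl : ∀ y, IsCompl (LinearMap.ker (mfderiv J I B.proj y).toLinearMap) (hor y)
  map_act : ∀ (y : P) (k : K),
    (hor y).map (mfderiv J J (fun z : P => z <• k) y).toLinearMap = hor (y <• k)
  smooth : ∀ y₀ : P, ∃ (U : Set P) (Z : Fin (Module.finrank ℝ EM) → ∀ y : P, TangentSpace J y),
    IsOpen U ∧ y₀ ∈ U ∧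
    (∀ i, ContMDiffOn J J.tangent ∞ (fun y => (⟨y, Z i y⟩ : TangentBundle J P)) U) ∧
    ∀ y ∈ U, LinearIndependent ℝ (fun i => Z i y) ∧
      Submodule.span ℝ (Set.range fun i => Z i y) = hor y

namespace Connection

variable {B} [IsManifold J ∞ P] (A : B.Connection)

/-- The isomorphism `dp_y : A_y ≃ T_{p(y)} M`. -/
def horEquiv (y : P) : A.hor y ≃ₗ[ℝ] TangentSpace I (B.proj y) :=
  LinearEquiv.ofBijective ((mfderiv J I B.proj y).toLinearMap.comp (A.hor y).subtype) (by
    constructor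
    · rw [← LinearMap.ker_eq_bot, LinearMap.ker_eq_bot']
      intro u hu
      have : (u : TangentSpace J y) ∈ (⊥ : Submodule ℝ (TangentSpace J y)) :=
        (A.isCompl y).disjoint.le_bot ⟨hu, u.2⟩
      exact Subtype.ext this
    · intro v
      obtain ⟨u, rfl⟩ := B.mfderiv_proj_surjective y v
      obtain ⟨w, hw, h, hh, rfl⟩ : ∃ w ∈ LinearMap.ker (mfderiv J I B.proj y).toLinearMap,
          ∃ h ∈ A.hor y, w + h = u := Submodule.mem_sup.1 (by
            rw [(A.isCompl y).sup_eq_top]; trivial)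
      refine ⟨⟨h, hh⟩, ?_⟩
      have hw' : mfderiv J I B.proj y w = 0 := hw
      show mfderiv J I B.proj y h = mfderiv J I B.proj y (w + h)
      rw [map_add, hw', zero_add])

/-- The horizontal lift to `y` of a tangent vector of `M` at `p(y)`. -/
def horLift (y : P) (v : TangentSpace I (B.proj y)) : TangentSpace J y :=
  (A.horEquiv y).symm v

/-- The horizontal lift `X̃` of a vector field `X` on `M`. -/
def horField (X : ∀ x : M, TangentSpace I x) (y : P) : TangentSpace J y :=
  A.horLift y (X (B.proj y))

section Curvature

variable [LieGroup IK ∞ K] [FiniteDimensional ℝ EP]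

/-- The connection form at `y`: it kills `A_y`, and maps `a^#_y` to `a`. -/
def connForm (y : P) : TangentSpace J y →L[ℝ] GroupLieAlgebra IK K :=
  have : FiniteDimensional ℝ (TangentSpace J y) := inferInstanceAs (FiniteDimensional ℝ EP)
  have : T2Space (TangentSpace J y) := inferInstanceAs (T2Space EP)
  LinearMap.toContinuousLinearMap
    ((B.verticalEquiv y).symm.toLinearMap.comp (Submodule.projectionOnto _ _ (A.isCompl y)))

/-- The connection form in the preferred chart around `y`: its pull-back under the inverse of the
chart, a `𝔨`-valued `1`-form on the target of the chart. -/
def connFormInChart (y : P) (z : EP) : EP →L[ℝ] EK :=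
  (A.connForm ((extChartAt J y).symm z)).comp (mfderiv 𝓘(ℝ, EP) J (extChartAt J y).symm z)

/-- The exterior derivative `dω_y(u, v)` of the connection form, calculated in the
preferred chart around `y`, with the convention `dω(U, V) = U ω(V) - V ω(U) - ω([U, V])`. -/
def dConnForm (y : P) (u v : TangentSpace J y) : GroupLieAlgebra IK K :=
  let u' : EP := mfderiv J 𝓘(ℝ, EP) (extChartAt J y) y u
  let v' : EP := mfderiv J 𝓘(ℝ, EP) (extChartAt J y) y v
  let dω : EP →L[ℝ] EP →L[ℝ] EK := fderiv ℝ (A.connFormInChart y) (extChartAt J y y)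
  (dω u' v' - dω v' u' : EK)

/-- The curvature `F_A`, a `2`-form on `M` with values in `ad(P)`: for tangent vectors `v`, `w` of
`M` at `x`, `F_A(v, w) = [y, dω_y(ṽ, w̃)]` with the horizontal lifts `ṽ`, `w̃` of `v`, `w` to a
point `y` over `x`. (By invariance of the connection, the class does not depend on `y`.) -/
def curvature (x : M) (v w : TangentSpace I x) : B.AdFiber x :=
  B.adMk (B.point x) (B.proj_point x)
    (A.dConnForm (B.point x) (A.horLift (B.point x) ((B.proj_point x).symm ▸ v))
      (A.horLift (B.point x) ((B.proj_point x).symm ▸ w)))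

/-- The covariant derivative `∇^A ν` of a section `ν` of `ad(P)`, a `1`-form on `M` with values in
`ad(P)`: for a tangent vector `v` of `M` at `x`, `∇^A_v ν = [y, dν̂_y(ṽ)]`, with the equivariant map
`ν̂ : P → 𝔨` of `ν` and the horizontal lift `ṽ` of `v` to a point `y` over `x`. (The class does not
depend on `y`.) -/
def covDeriv (ν : B.AdSection) (x : M) (v : TangentSpace I x) : B.AdFiber x :=
  B.adMk (B.point x) (B.proj_point x)
    (mfderiv (M' := EK) J 𝓘(ℝ, EK) (B.equivariantMap ν.toFun) (B.point x)
      (A.horLift (B.point x) ((B.proj_point x).symm ▸ v)) : EK)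

/-- The generalized moment map equation `ι_X F_A = -∇^A ν`. -/
def GeneralizedMomentMapEquation (X : ∀ x : M, TangentSpace I x) (ν : B.AdSection) : Prop :=
  ∀ (x : M) (v : TangentSpace I x), A.curvature x (X x) v = -A.covDeriv ν x v

end Curvature

/-- The connection `A` is invariant under the local flow `β` of the vector field `Y` on `P`:
`(β_t)_* A_y = A_{β_t(y)}` for all `(t, y)` for which `β_t(y)` is defined. -/
def InvariantUnderFlow (Y : ∀ y : P, TangentSpace J y) : Prop :=
  ∀ (t : ℝ) (y : P), FlowDefined J Y t y →
    (A.hor y).map (mfderiv J J (localFlow J Y t) y).toLinearMap = A.hor (localFlow J Y t y)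

end Connection

end PrincipalBundle
end

/-!
Write `Y = X̃ + ξ^ν` for the lifted field, `β` for its local flow and `ω` for the connection form,
so that `ω(Y) = ν̂` and `A = ker ω`. The theorem is Cartan's formula
`d/dt|₀ β_t^* ω = L_Y ω = ι_Y dω + dν̂`, whose right hand side is `Connection.lieForm`.

On a horizontal vector `u` one has `ι_Y dω(u) = ι_X̃ dω(u)`, because `dω(a^#, u) = 0`: apply
Cartan's formula to the fundamental field `a^#`, for which `ω(a^#) = a` is constant and whose flow,
right translation by a one-parameter group, preserves `A`. Hence the moment map equation says that
`L_Y ω` vanishes on horizontal vectors, at one point of each fibre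
(`Connection.generalizedMomentMapEquation_iff`).

If `A` is invariant, then `β_t^* ω` vanishes on horizontal vectors for small `t`, and so does its
derivative (`Connection.lieForm_eq_zero_of_invariantUnderFlow`). Conversely, `Y` is invariant under
the structure group, so `β` commutes with the action. Therefore `L_Y ω` is equivariant, which moves
its vanishing from one point to the whole fibre, and it vanishes on vertical vectors, since `β`
preserves the fundamental fields (`Connection.lieForm_eq_zero`). Then `β_t^* ω` has derivative zero
at all times of a flow line and is constant along it, so that `β_t` maps `A_y` into `A_{β_t(y)}`,
and onto it by the same argument for the inverse `β_{-t}`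
(`Connection.invariantUnderFlow_of_lieForm_eq_zero`).

The analytic part consists in the facts on `localFlow` that this uses: the group law, and the
differentiability in the initial point with the variational equation for the derivative
(`ContDiffAt.exists_local_flow_hasFDerivAt`, `FlowDefined.eventually_and_mdifferentiableAt`), which
give Cartan's formula for any `1`-form (`hasDerivAt_localFlow_pullback`). Smoothness of `ω` and of
`Y` comes from inverting the isomorphisms `(c, a) ↦ ∑ cᵢ Zᵢ + a^#`, for a horizontal frame `Z`, and
`(dp, ω)`.

Tangent spaces of a manifold are copies of its model vector space. Derivatives are regarded as
linear maps of the model spaces (`modelDeriv`), so that their types do not depend on base points.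
-/

/-! ### Differentiability of local flows in normed spaces -/

section FlowNormed

open Metric Set

variable {E : Type*} [NormedAddCommGroup E] [NormedSpace ℝ E]

/-- A two-sided form of Grönwall's inequality. -/
theorem norm_le_gronwallBound_abs {e e' : ℝ → E} {C δ ε : ℝ}
    (he : ∀ t ∈ Ioo (-ε) ε, HasDerivAt e (e' t) t) (h0 : e 0 = 0)
    (hb : ∀ t ∈ Ioo (-ε) ε, ‖e' t‖ ≤ C * ‖e t‖ + δ) {t : ℝ} (ht : t ∈ Ioo (-ε) ε) :
    ‖e t‖ ≤ gronwallBound 0 C δ |t| := by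
  -- the one-sided inequality, to be applied to `e` and to `e ∘ (-·)`
  have key : ∀ {g g' : ℝ → E}, (∀ t ∈ Ioo (-ε) ε, HasDerivAt g (g' t) t) → g 0 = 0 →
      (∀ t ∈ Ioo (-ε) ε, ‖g' t‖ ≤ C * ‖g t‖ + δ) → ∀ s, 0 ≤ s → s < ε →
      ‖g s‖ ≤ gronwallBound 0 C δ s := by
    intro g g' hg hg0 hgb s hs hsε
    have hsub : ∀ x ∈ Icc 0 s, x ∈ Ioo (-ε) ε := fun x hx =>
      ⟨by linarith [hx.1], by linarith [hx.2]⟩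
    have := norm_le_gronwallBound_of_norm_deriv_right_le (f := g) (f' := g') (δ := 0) (K := C)
      (ε := δ) (a := 0) (b := s)
      (fun x hx => (hg x (hsub x hx)).continuousAt.continuousWithinAt)
      (fun x hx => (hg x (hsub x (Ico_subset_Icc_self hx))).hasDerivWithinAt)
      (by simp [hg0]) (fun x hx => hgb x (hsub x (Ico_subset_Icc_self hx))) s ⟨hs, le_rfl⟩
    simpa using this
  rcases le_total 0 t with h | h
  · rw [abs_of_nonneg h]; exact key he h0 hb t h ht.2
  · rw [abs_of_nonpos h]
    have hneg : ∀ {s : ℝ}, s ∈ Ioo (-ε) ε → -s ∈ Ioo (-ε) ε := fun hs =>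
      ⟨by linarith [hs.2], by linarith [hs.1]⟩
    have := key (g := fun s => e (-s)) (g' := fun s => -e' (-s))
      (fun s hs => by
        simpa [Function.comp_def] using (he (-s) (hneg hs)).scomp s (hasDerivAt_neg s))
      (by simpa using h0)
      (fun s hs => by simpa using hb (-s) (hneg hs)) (-t) (by linarith) (by linarith [ht.1])
    simpa using this

/-- The local flow of a `C¹` vector field, uniformly Lipschitz in the initial point and with orbits
confined to a prescribed neighbourhood. -/
theorem ContDiffAt.exists_local_flow_lipschitz [CompleteSpace E] {v : E → E} {z₀ : E}
    (hv : ContDiffAt ℝ 1 v z₀) {N : Set E} (hN : N ∈ 𝓝 z₀) :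
    ∃ (α : E → ℝ → E) (L : NNReal), ∃ ρ > (0 : ℝ), ∃ ε > (0 : ℝ),
      (∀ z ∈ ball z₀ ρ, α z 0 = z ∧
        ∀ t ∈ Ioo (-ε) ε, HasDerivAt (α z) (v (α z t)) t ∧ α z t ∈ N) ∧
      ∀ t ∈ Ioo (-ε) ε, LipschitzOnWith L (α · t) (ball z₀ ρ) := by
  obtain ⟨ε₀, hε₀, a, r, L₀, C, hr, hpl⟩ := IsPicardLindelof.of_contDiffAt_one hv
  obtain ⟨α, hα, L, hL⟩ :=
    (hpl 0).exists_forall_mem_closedBall_eq_hasDerivWithinAt_lipschitzOnWith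
  simp only [zero_sub, zero_add] at hα hL
  have hr' : (0 : ℝ) < r := hr
  have hz₀ : z₀ ∈ closedBall z₀ (r : ℝ) := mem_closedBall_self hr'.le
  have hcont : ContinuousOn (Function.uncurry α) (closedBall z₀ r ×ˢ Icc (-ε₀) ε₀) :=
    continuousOn_prod_of_continuousOn_lipschitzOnWith _ L
      (fun x hx => HasDerivWithinAt.continuousOn (hα x hx).2) hL
  have hca : ContinuousAt (Function.uncurry α) (z₀, 0) :=
    hcont.continuousAt (prod_mem_nhds (closedBall_mem_nhds z₀ hr')
      (Icc_mem_nhds (by linarith) hε₀))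
  have hN' : Function.uncurry α ⁻¹' N ∈ 𝓝 (z₀, (0 : ℝ)) := hca (by
    simpa [Function.uncurry, (hα z₀ hz₀).1] using hN)
  obtain ⟨δ, hδ, hball⟩ := Metric.mem_nhds_iff.1 hN'
  refine ⟨α, L, min r δ, lt_min hr' hδ, min ε₀ δ, lt_min hε₀ hδ, ?_, ?_⟩
  · intro z hz
    have hzr : z ∈ closedBall z₀ (r : ℝ) :=
      ball_subset_closedBall (ball_subset_ball (min_le_left _ _) hz)
    refine ⟨(hα z hzr).1, fun t ht => ⟨?_, ?_⟩⟩
    · have ht' : t ∈ Ioo (-ε₀) ε₀ :=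
        ⟨by linarith [ht.1, min_le_left ε₀ δ], by linarith [ht.2, min_le_left ε₀ δ]⟩
      exact ((hα z hzr).2 t (Ioo_subset_Icc_self ht')).hasDerivAt (Icc_mem_nhds ht'.1 ht'.2)
    · have : (z, t) ∈ ball (z₀, (0 : ℝ)) δ := by
        rw [← ball_prod_same]
        refine ⟨ball_subset_ball (min_le_right _ _) hz, ?_⟩
        rw [Real.ball_eq_Ioo]
        exact ⟨by linarith [ht.1, min_le_right ε₀ δ], by linarith [ht.2, min_le_right ε₀ δ]⟩
      exact hball this
  · intro t ht
    exact (hL t ⟨by linarith [ht.1, min_le_left ε₀ δ], by linarith [ht.2, min_le_left ε₀ δ]⟩).mono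
      fun z hz => ball_subset_closedBall (ball_subset_ball (min_le_left _ _) hz)

/-- The second order Taylor estimate for a `C²` map, uniform near a point. -/
theorem ContDiffAt.exists_norm_sub_sub_fderiv_le {F : Type*} [NormedAddCommGroup F]
    [NormedSpace ℝ F] {v : E → F} {z₀ : E} (hv : ContDiffAt ℝ 2 v z₀) :
    ∃ C > (0 : ℝ), ∃ r > (0 : ℝ), ∀ a ∈ ball z₀ r, ‖fderiv ℝ v a‖ ≤ C ∧
      ∀ b ∈ ball z₀ r, ‖v b - v a - fderiv ℝ v a (b - a)‖ ≤ C * ‖b - a‖ ^ 2 := by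
  have hd : ContDiffAt ℝ 1 (fderiv ℝ v) z₀ := hv.fderiv_right (by norm_num)
  obtain ⟨C, s, hs, hlip⟩ := hd.exists_lipschitzOnWith
  have hdiff : ∀ᶠ z in 𝓝 z₀, DifferentiableAt ℝ v z := by
    filter_upwards [hv.eventually (by simp)] with z hz using hz.differentiableAt (by simp)
  have hbd : ∀ᶠ z in 𝓝 z₀, ‖fderiv ℝ v z‖ < ‖fderiv ℝ v z₀‖ + 1 :=
    hd.continuousAt.norm.eventually (gt_mem_nhds (by linarith))
  obtain ⟨r, hr, hball⟩ := Metric.eventually_nhds_iff_ball.1 ((Filter.eventually_mem_set.2 hs).and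
    (hdiff.and hbd))
  -- `C` is a Lipschitz constant of `fderiv ℝ v` near `z₀`, the other summands bound its norm there
  refine ⟨C + ‖fderiv ℝ v z₀‖ + 1, by positivity, r, hr, fun a ha => ⟨?_, fun b hb => ?_⟩⟩
  · have := (hball a ha).2.2
    have hC : (0 : ℝ) ≤ C := C.2
    linarith
  · have hseg : segment ℝ a b ⊆ ball z₀ r := (convex_ball z₀ r).segment_subset ha hb
    have h1 : ∀ x ∈ segment ℝ a b, ‖fderiv ℝ v x - fderiv ℝ v a‖ ≤ C * ‖b - a‖ := by
      intro x hx
      refine (hlip.norm_sub_le (hball x (hseg hx)).1 (hball a ha).1).trans ?_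
      have : ‖x - a‖ ≤ ‖b - a‖ := by
        have := (convex_closedBall a ‖b - a‖).segment_subset
          (mem_closedBall_self (norm_nonneg _)) (mem_closedBall_iff_norm.2 le_rfl) hx
        exact mem_closedBall_iff_norm.1 this
      gcongr
    have h2 := (convex_segment a b).norm_image_sub_le_of_norm_hasFDerivWithin_le'
      (fun x hx => (hball x (hseg hx)).2.1.hasFDerivAt.hasFDerivWithinAt) h1
      (left_mem_segment ℝ a b) (right_mem_segment ℝ a b)
    refine h2.trans ?_
    have : (0 : ℝ) ≤ ‖fderiv ℝ v z₀‖ + 1 := by positivity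
    nlinarith [mul_nonneg this (sq_nonneg ‖b - a‖)]

/-- The local flow of a `C²` vector field is differentiable in the initial point. Its derivative
`J` solves the variational equation `J' = Dv ∘ J`, `J(0) = 1`; the solution is obtained by
integrating the vector field `(z, S) ↦ (v z, Dv_z ∘ S)`, and Grönwall's inequality shows that it is
the derivative. -/
theorem ContDiffAt.exists_local_flow_hasFDerivAt [CompleteSpace E] {v : E → E} {z₀ : E}
    (hv : ContDiffAt ℝ 2 v z₀) {N : Set E} (hN : N ∈ 𝓝 z₀) :
    ∃ (f : E → ℝ → E) (J : E → ℝ → E →L[ℝ] E), ∃ ρ > (0 : ℝ), ∃ ε > (0 : ℝ),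
      ∀ z ∈ ball z₀ ρ, f z 0 = z ∧ J z 0 = ContinuousLinearMap.id ℝ E ∧
        HasDerivAt (J z) (fderiv ℝ v z) 0 ∧
        ∀ t ∈ Ioo (-ε) ε, HasDerivAt (f z) (v (f z t)) t ∧ f z t ∈ N ∧
          HasFDerivAt (fun w => f w t) (J z t) z := by
  obtain ⟨C, hC, r, hr, hT⟩ := hv.exists_norm_sub_sub_fderiv_le
  have hd : ContDiffAt ℝ 1 (fderiv ℝ v) z₀ := hv.fderiv_right (by norm_num)
  set p₀ : E × (E →L[ℝ] E) := (z₀, ContinuousLinearMap.id ℝ E) with hp₀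
  set G : E × (E →L[ℝ] E) → E × (E →L[ℝ] E) := fun p => (v p.1, (fderiv ℝ v p.1).comp p.2) with hG
  have hGc : ContDiffAt ℝ 1 G p₀ := by
    refine ContDiffAt.prodMk ?_ ?_
    · exact ContDiffAt.comp p₀ (g := v) (hv.of_le (by norm_num)) contDiffAt_fst
    · exact ContDiffAt.clm_comp (ContDiffAt.comp p₀ (g := fderiv ℝ v) hd contDiffAt_fst)
        contDiffAt_snd
  have hN' : Prod.fst ⁻¹' (N ∩ ball z₀ r) ∈ 𝓝 p₀ :=
    continuousAt_fst (Filter.inter_mem hN (ball_mem_nhds z₀ hr))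
  obtain ⟨α, L, ρ, hρ, ε, hε, hα, hL⟩ := hGc.exists_local_flow_lipschitz hN'
  have hmem : ∀ z ∈ ball z₀ ρ, (z, ContinuousLinearMap.id ℝ E) ∈ ball p₀ ρ := by
    intro z hz
    rw [hp₀, ← ball_prod_same]
    exact ⟨hz, mem_ball_self hρ⟩
  refine ⟨fun z t => (α (z, ContinuousLinearMap.id ℝ E) t).1,
    fun z t => (α (z, ContinuousLinearMap.id ℝ E) t).2, ρ, hρ, ε, hε, fun z hz => ?_⟩
  have hfst : ∀ w ∈ ball z₀ ρ, ∀ t ∈ Ioo (-ε) ε,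
      HasDerivAt (fun t => (α (w, ContinuousLinearMap.id ℝ E) t).1)
        (v (α (w, ContinuousLinearMap.id ℝ E) t).1) t := fun w hw t ht =>
    ((hα _ (hmem w hw)).2 t ht).1.fst
  have hsnd : ∀ w ∈ ball z₀ ρ, ∀ t ∈ Ioo (-ε) ε,
      HasDerivAt (fun t => (α (w, ContinuousLinearMap.id ℝ E) t).2)
        ((fderiv ℝ v (α (w, ContinuousLinearMap.id ℝ E) t).1).comp
          (α (w, ContinuousLinearMap.id ℝ E) t).2) t := fun w hw t ht =>
    ((hα _ (hmem w hw)).2 t ht).1.snd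
  have hz0 := (hα _ (hmem z hz)).1
  refine ⟨by simp [hz0], by simp [hz0], ?_, fun t ht => ⟨hfst z hz t ht,
    ((hα _ (hmem z hz)).2 t ht).2.1, ?_⟩⟩
  · have := hsnd z hz 0 ⟨by linarith, hε⟩
    simpa [hz0] using this
  set f : E → ℝ → E := fun z t => (α (z, ContinuousLinearMap.id ℝ E) t).1 with hf
  set J : E → ℝ → E →L[ℝ] E := fun z t => (α (z, ContinuousLinearMap.id ℝ E) t).2 with hJ
  -- the Lipschitz bound of the combined flow bounds its first component
  have hLip : ∀ w ∈ ball z₀ ρ, ∀ s ∈ Ioo (-ε) ε, ‖f w s - f z s‖ ≤ L * ‖w - z‖ := by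
    intro w hw s hs
    have h1 := (hL s hs).norm_sub_le (hmem w hw) (hmem z hz)
    have h2 : ‖((w, ContinuousLinearMap.id ℝ E) : E × (E →L[ℝ] E)) -
        (z, ContinuousLinearMap.id ℝ E)‖ = ‖w - z‖ := by
      rw [Prod.mk_sub_mk, sub_self, Prod.norm_mk, norm_zero, max_eq_left (norm_nonneg _)]
    rw [h2] at h1
    exact (norm_fst_le _).trans h1
  -- the value at `|t|` of the Grönwall bound with error term `C * (L * ‖w - z‖) ^ 2`, divided by
  -- `‖w - z‖ ^ 2`
  set D : ℝ := L ^ 2 * (Real.exp (C * |t|) - 1) with hD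
  have hbound : ∀ w ∈ ball z₀ ρ, ‖f w t - f z t - J z t (w - z)‖ ≤ D * ‖w - z‖ ^ 2 := by
    intro w hw
    have := norm_le_gronwallBound_abs (e := fun s => f w s - f z s - J z s (w - z))
      (e' := fun s => v (f w s) - v (f z s) - fderiv ℝ v (f z s) (J z s (w - z)))
      (C := C) (δ := C * (L * ‖w - z‖) ^ 2) (ε := ε)
      (fun s hs => ((hfst w hw s hs).sub (hfst z hz s hs)).sub
        ((hsnd z hz s hs).clm_apply (hasDerivAt_const s (w - z)) |>.congr_deriv (by simp [hf, hJ])))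
      (by simp [hf, hJ, (hα _ (hmem w hw)).1, hz0]) ?_ ht
    · rw [gronwallBound_of_K_ne_0 hC.ne'] at this
      refine this.trans (le_of_eq ?_)
      rw [hD]; field_simp; ring
    · intro s hs
      have ha := ((hα _ (hmem z hz)).2 s hs).2.2
      have hb := ((hα _ (hmem w hw)).2 s hs).2.2
      have hT1 := (hT _ ha).1
      have hT2 := (hT _ ha).2 _ hb
      have hsplit : v (f w s) - v (f z s) - fderiv ℝ v (f z s) (J z s (w - z))
          = fderiv ℝ v (f z s) (f w s - f z s - J z s (w - z))
            + (v (f w s) - v (f z s) - fderiv ℝ v (f z s) (f w s - f z s)) := by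
        simp only [map_sub]; abel
      rw [hsplit]
      refine (norm_add_le _ _).trans (add_le_add ?_ ?_)
      · exact (ContinuousLinearMap.le_opNorm _ _).trans
          (mul_le_mul_of_nonneg_right hT1 (norm_nonneg _))
      · exact hT2.trans (mul_le_mul_of_nonneg_left
          (pow_le_pow_left₀ (norm_nonneg _) (hLip w hw s hs) 2) hC.le)
  have hO : (fun w => f w t - f z t - J z t (w - z)) =O[𝓝 z] fun w => ‖w - z‖ ^ 2 := by
    refine Asymptotics.IsBigO.of_bound D ?_
    filter_upwards [isOpen_ball.mem_nhds hz] with w hw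
    simpa using hbound w hw
  have h0 : HasFDerivAt (fun w => f w t - f z t - J z t (w - z)) (0 : E →L[ℝ] E) z :=
    hO.hasFDerivAt (by norm_num)
  have h1 := (h0.add ((J z t).hasFDerivAt.sub_const (J z t z))).add_const (f z t)
  refine (h1.congr_fderiv (by ext; simp)).congr_of_eventuallyEq (Filter.Eventually.of_forall ?_)
  intro w
  simp [hf, hJ]

end FlowNormed

/-! ### Derivatives on manifolds as maps of the model spaces -/

section ModelDeriv

variable {E₁ H₁ : Type*} [NormedAddCommGroup E₁] [NormedSpace ℝ E₁] [TopologicalSpace H₁]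
  {I₁ : ModelWithCorners ℝ E₁ H₁} {M₁ : Type*} [TopologicalSpace M₁] [ChartedSpace H₁ M₁]
  {E₂ H₂ : Type*} [NormedAddCommGroup E₂] [NormedSpace ℝ E₂] [TopologicalSpace H₂]
  {I₂ : ModelWithCorners ℝ E₂ H₂} {M₂ : Type*} [TopologicalSpace M₂] [ChartedSpace H₂ M₂]
  {E₃ H₃ : Type*} [NormedAddCommGroup E₃] [NormedSpace ℝ E₃] [TopologicalSpace H₃]
  {I₃ : ModelWithCorners ℝ E₃ H₃} {M₃ : Type*} [TopologicalSpace M₃] [ChartedSpace H₃ M₃]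

variable (I₁ I₂) in
/-- The derivative `mfderiv` of a map of manifolds, regarded as a linear map of the model vector
spaces, of which the tangent spaces are copies. Its type does not depend on the base point. -/
noncomputable def modelDeriv (f : M₁ → M₂) (x : M₁) : E₁ →L[ℝ] E₂ := mfderiv I₁ I₂ f x

theorem modelDeriv_comp {g : M₂ → M₃} {f : M₁ → M₂} {x : M₁}
    (hg : MDifferentiableAt I₂ I₃ g (f x)) (hf : MDifferentiableAt I₁ I₂ f x) :
    modelDeriv I₁ I₃ (fun y => g (f y)) x
      = (modelDeriv I₂ I₃ g (f x)).comp (modelDeriv I₁ I₂ f x) :=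
  mfderiv_comp (I' := I₂) x hg hf

theorem modelDeriv_comp_apply {g : M₂ → M₃} {f : M₁ → M₂} {x : M₁}
    (hg : MDifferentiableAt I₂ I₃ g (f x)) (hf : MDifferentiableAt I₁ I₂ f x) (u : E₁) :
    modelDeriv I₁ I₃ (fun y => g (f y)) x u
      = modelDeriv I₂ I₃ g (f x) (modelDeriv I₁ I₂ f x u) := by
  rw [modelDeriv_comp hg hf]; rfl

theorem Filter.EventuallyEq.modelDeriv_eq {f g : M₁ → M₂} {x : M₁} (h : f =ᶠ[𝓝 x] g) :
    modelDeriv I₁ I₂ f x = modelDeriv I₁ I₂ g x :=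
  h.mfderiv_eq

theorem modelDeriv_id (x : M₁) :
    modelDeriv I₁ I₁ (fun y => y) x = ContinuousLinearMap.id ℝ E₁ :=
  mfderiv_id

theorem modelDeriv_const (x : M₁) (c : M₂) : modelDeriv I₁ I₂ (fun _ => c) x = 0 :=
  mfderiv_const

theorem modelDeriv_eq_fderiv (f : E₁ → E₂) (x : E₁) :
    modelDeriv 𝓘(ℝ, E₁) 𝓘(ℝ, E₂) f x = fderiv ℝ f x :=
  mfderiv_eq_fderiv

theorem MDifferentiableAt.hasMFDerivAt_modelDeriv {f : M₁ → M₂} {x : M₁}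
    (h : MDifferentiableAt I₁ I₂ f x) :
    HasMFDerivAt I₁ I₂ f x (modelDeriv I₁ I₂ f x : E₁ →L[ℝ] E₂) :=
  h.hasMFDerivAt

/-- The partial derivatives of a map on a product add up to its derivative. -/
theorem modelDeriv_prod_apply {f : M₁ × M₂ → M₃} {p : M₁ × M₂}
    (hf : MDifferentiableAt (I₁.prod I₂) I₃ f p) (u : E₁) (w : E₂) :
    modelDeriv (I₁.prod I₂) I₃ f p (u, w)
      = modelDeriv I₁ I₃ (fun x => f (x, p.2)) p.1 u
        + modelDeriv I₂ I₃ (fun y => f (p.1, y)) p.2 w :=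
  mfderiv_prod_eq_add_apply (v := (u, w)) hf

end ModelDeriv

/-! ### Charts and vector fields -/

section Charts

variable {E H : Type*} [NormedAddCommGroup E] [NormedSpace ℝ E] [TopologicalSpace H]
  {J : ModelWithCorners ℝ E H} {P : Type*} [TopologicalSpace P]
  [ChartedSpace H P] [IsManifold J ∞ P]

theorem mdifferentiableAt_extChartAt_of_mem {y₀ y : P} (hy : y ∈ (extChartAt J y₀).source) :
    MDifferentiableAt J 𝓘(ℝ, E) (extChartAt J y₀) y :=
  mdifferentiableAt_extChartAt (by rwa [extChartAt_source] at hy)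

variable [J.Boundaryless]

theorem contMDiffAt_extChartAt_symm {y₀ : P} {z : E} (hz : z ∈ (extChartAt J y₀).target) :
    ContMDiffAt 𝓘(ℝ, E) J ∞ (extChartAt J y₀).symm z :=
  (contMDiffOn_extChartAt_symm y₀).contMDiffAt ((isOpen_extChartAt_target y₀).mem_nhds hz)

theorem mdifferentiableAt_extChartAt_symm {y₀ : P} {z : E} (hz : z ∈ (extChartAt J y₀).target) :
    MDifferentiableAt 𝓘(ℝ, E) J (extChartAt J y₀).symm z :=
  (contMDiffAt_extChartAt_symm hz).mdifferentiableAt (by simp)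

theorem modelDeriv_extChartAt_symm {y₀ : P} {z : E} (hz : z ∈ (extChartAt J y₀).target) (u : E) :
    modelDeriv J 𝓘(ℝ, E) (extChartAt J y₀) ((extChartAt J y₀).symm z)
      (modelDeriv 𝓘(ℝ, E) J (extChartAt J y₀).symm z u) = u := by
  rw [← modelDeriv_comp_apply
    (mdifferentiableAt_extChartAt_of_mem ((extChartAt J y₀).map_target hz))
    (mdifferentiableAt_extChartAt_symm hz)]
  have : (fun w => extChartAt J y₀ ((extChartAt J y₀).symm w)) =ᶠ[𝓝 z] fun w => w := by
    filter_upwards [(isOpen_extChartAt_target y₀).mem_nhds hz] with w hw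
    exact (extChartAt J y₀).right_inv hw
  rw [this.modelDeriv_eq, modelDeriv_id]; rfl

theorem modelDeriv_symm_extChartAt {y₀ y : P} (hy : y ∈ (extChartAt J y₀).source) (u : E) :
    modelDeriv 𝓘(ℝ, E) J (extChartAt J y₀).symm (extChartAt J y₀ y)
      (modelDeriv J 𝓘(ℝ, E) (extChartAt J y₀) y u) = u := by
  rw [← modelDeriv_comp_apply
    (mdifferentiableAt_extChartAt_symm ((extChartAt J y₀).map_source hy))
    (mdifferentiableAt_extChartAt_of_mem hy)]
  have : (fun w => (extChartAt J y₀).symm (extChartAt J y₀ w)) =ᶠ[𝓝 y] fun w => w := by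
    filter_upwards [(isOpen_extChartAt_source y₀).mem_nhds hy] with w hw
    exact (extChartAt J y₀).left_inv hw
  rw [this.modelDeriv_eq, modelDeriv_id]; rfl

theorem modelDeriv_symm_extChartAt_symm {y₀ : P} {z : E} (hz : z ∈ (extChartAt J y₀).target)
    (u : E) :
    modelDeriv 𝓘(ℝ, E) J (extChartAt J y₀).symm z
      (modelDeriv J 𝓘(ℝ, E) (extChartAt J y₀) ((extChartAt J y₀).symm z) u) = u := by
  have := modelDeriv_symm_extChartAt ((extChartAt J y₀).map_target hz) u
  rwa [(extChartAt J y₀).right_inv hz] at this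

/-- A function is smooth at `y₀` if its expression in the chart at `y₀` is. -/
theorem contMDiffAt_iff_comp_extChartAt_symm {F : Type*} [NormedAddCommGroup F] [NormedSpace ℝ F]
    {f : P → F} {y₀ : P} {n : ℕ∞} :
    ContMDiffAt J 𝓘(ℝ, F) n f y₀ ↔
      ContDiffAt ℝ n (fun z => f ((extChartAt J y₀).symm z)) (extChartAt J y₀ y₀) := by
  have hz : extChartAt J y₀ y₀ ∈ (extChartAt J y₀).target := mem_extChartAt_target y₀
  have hn : ((n : ℕ∞) : WithTop ℕ∞) ≤ ∞ := by exact_mod_cast le_top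
  constructor
  · intro h
    rw [← contMDiffAt_iff_contDiffAt]
    refine ContMDiffAt.comp (extChartAt J y₀ y₀) (g := f) ?_
      ((contMDiffAt_extChartAt_symm hz).of_le hn)
    rwa [(extChartAt J y₀).left_inv (mem_extChartAt_source y₀)]
  · intro h
    rw [← contMDiffAt_iff_contDiffAt] at h
    have hc : ContMDiffAt J 𝓘(ℝ, E) n (extChartAt J y₀) y₀ :=
      (contMDiffAt_extChartAt (n := ∞)).of_le hn
    refine (ContMDiffAt.comp y₀ h hc).congr_of_eventuallyEq ?_
    filter_upwards [extChartAt_source_mem_nhds (I := J) y₀] with w hw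
    exact congrArg f ((extChartAt J y₀).left_inv hw).symm

variable (J) in
/-- The expression of a vector field on a manifold in the preferred chart at `y₀`. It
is meaningful on the target of the chart. -/
noncomputable def chartField (y₀ : P) (Y : P → E) (z : E) : E :=
  modelDeriv J 𝓘(ℝ, E) (extChartAt J y₀) ((extChartAt J y₀).symm z) (Y ((extChartAt J y₀).symm z))

/-- A vector field is smooth at `y₀` if its expression in the chart at `y₀` is. -/
theorem contMDiffAt_iff_chartField {Y : ∀ y : P, TangentSpace J y} {y₀ : P} {n : ℕ∞} :
    ContMDiffAt J J.tangent n (fun y => (⟨y, Y y⟩ : TangentBundle J P)) y₀ ↔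
      ContDiffAt ℝ n (chartField J y₀ Y) (extChartAt J y₀ y₀) := by
  -- the trivialization of the tangent bundle at `y₀` is the derivative of the chart
  have h1 : (fun y => (trivializationAt E (TangentSpace J) y₀ ⟨y, Y y⟩).2) =ᶠ[𝓝 y₀]
      fun y => modelDeriv J 𝓘(ℝ, E) (extChartAt J y₀) y (Y y) := by
    filter_upwards [chart_source_mem_nhds H y₀] with y hy
    have h := TangentBundle.continuousLinearMapAt_trivializationAt (I := J) (x₀ := y₀) hy
    have h' := congrArg (fun L : E →L[ℝ] E => L (Y y)) h
    refine Eq.trans ?_ h'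
    have := (trivializationAt E (TangentSpace J) y₀).coe_linearMapAt_of_mem (R := ℝ) (b := y) hy
    exact (congrFun this (Y y)).symm
  have h2 := Bundle.contMDiffAt_section (IB := J) (F := E) (E := TangentSpace J) (n := n)
    (s := Y) y₀
  refine h2.trans ?_
  rw [h1.contMDiffAt_iff]
  exact contMDiffAt_iff_comp_extChartAt_symm

/-- The image under the inverse chart of an integral curve of `chartField` is an integral curve. -/
theorem hasMFDerivAt_extChartAt_symm_comp {Y : ∀ y : P, TangentSpace J y} {y₀ : P} {α : ℝ → E}
    {t : ℝ} (ht : α t ∈ (extChartAt J y₀).target)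
    (hα : HasDerivAt α (chartField J y₀ Y (α t)) t) :
    HasMFDerivAt 𝓘(ℝ, ℝ) J (fun s => (extChartAt J y₀).symm (α s)) t
      ((1 : ℝ →L[ℝ] ℝ).smulRight (Y ((extChartAt J y₀).symm (α t))) : ℝ →L[ℝ] E) := by
  have h1 := (mdifferentiableAt_extChartAt_symm ht).hasMFDerivAt_modelDeriv
  have h2 : HasMFDerivAt 𝓘(ℝ, ℝ) 𝓘(ℝ, E) α t
      ((1 : ℝ →L[ℝ] ℝ).smulRight (chartField J y₀ Y (α t)) : ℝ →L[ℝ] E) :=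
    hα.hasFDerivAt.hasMFDerivAt
  have h3 := HasMFDerivAt.comp t h1 h2
  have h4 : (modelDeriv 𝓘(ℝ, E) J (extChartAt J y₀).symm (α t)).comp
      ((1 : ℝ →L[ℝ] ℝ).smulRight (chartField J y₀ Y (α t)) : ℝ →L[ℝ] E)
      = ((1 : ℝ →L[ℝ] ℝ).smulRight (Y ((extChartAt J y₀).symm (α t)) : E) : ℝ →L[ℝ] E) := by
    ext
    simp only [ContinuousLinearMap.comp_apply, ContinuousLinearMap.smulRight_apply, map_smul]
    exact congrArg _ (modelDeriv_symm_extChartAt_symm ht _)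
  rw [← h4]
  exact h3

end Charts

/-! ### Local flows on manifolds -/

section Map

variable {E H : Type*} [NormedAddCommGroup E] [NormedSpace ℝ E] [TopologicalSpace H]
  {J : ModelWithCorners ℝ E H} {P : Type*} [TopologicalSpace P] [ChartedSpace H P]
  {E' H' : Type*} [NormedAddCommGroup E'] [NormedSpace ℝ E'] [TopologicalSpace H']
  {J' : ModelWithCorners ℝ E' H'} {P' : Type*} [TopologicalSpace P'] [ChartedSpace H' P']

/-- A map that relates two vector fields maps integral curves to integral curves. -/
theorem IsMIntegralCurveOn.map {Y : ∀ y : P, TangentSpace J y} {Y' : ∀ y : P', TangentSpace J' y}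
    {γ : ℝ → P} {s : Set ℝ} (hγ : IsMIntegralCurveOn (I := J) γ Y s) {f : P → P'}
    (hf : ∀ t ∈ s, MDifferentiableAt J J' f (γ t))
    (hY : ∀ t ∈ s, modelDeriv J J' f (γ t) (Y (γ t)) = Y' (f (γ t))) :
    IsMIntegralCurveOn (I := J') (fun t => f (γ t)) Y' s := by
  intro t ht
  have h := (hf t ht).hasMFDerivAt.comp_hasMFDerivWithinAt t (hγ t ht)
  refine h.congr_mfderiv ?_
  ext
  symm
  refine Eq.trans (one_smul ℝ (Y' (f (γ t)) : E')) (Eq.trans (hY t ht).symm ?_)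
  exact congrArg (modelDeriv J J' f (γ t)) (one_smul ℝ (Y (γ t) : E)).symm

end Map

section LocalFlow

open Set Filter

variable {E H : Type*} [NormedAddCommGroup E] [NormedSpace ℝ E] [TopologicalSpace H]
  {J : ModelWithCorners ℝ E H} [J.Boundaryless] {P : Type*} [TopologicalSpace P]
  [ChartedSpace H P] [IsManifold J ∞ P] [T2Space P]
  {Y : ∀ y : P, TangentSpace J y}

/-- Uniqueness of integral curves: any integral curve from `γ 0` calculates the local flow. -/
theorem localFlow_eq_of_isMIntegralCurveOn
    (hY : ContMDiff J J.tangent ∞ (fun y => (⟨y, Y y⟩ : TangentBundle J P)))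
    {γ : ℝ → P} {a b t : ℝ} (h0 : (0 : ℝ) ∈ Ioo a b) (ht : t ∈ Ioo a b)
    (hγ : IsMIntegralCurveOn (I := J) γ Y (Ioo a b)) :
    FlowDefined J Y t (γ 0) ∧ localFlow J Y t (γ 0) = γ t := by
  have hdef : FlowDefined J Y t (γ 0) := ⟨γ, rfl, a, b, h0, ht, hγ⟩
  refine ⟨hdef, ?_⟩
  rw [localFlow, dif_pos hdef]
  obtain ⟨h0', a', b', hz', ht', hγ'⟩ := hdef.choose_spec
  exact isMIntegralCurveOn_Ioo_eqOn_of_contMDiff_boundaryless (t₀ := 0)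
    (a := max a' a) (b := min b' b) ⟨max_lt hz'.1 h0.1, lt_min hz'.2 h0.2⟩
    (hY.of_le (by simp)) (hγ'.mono (Ioo_subset_Ioo (le_max_left _ _) (min_le_left _ _)))
    (hγ.mono (Ioo_subset_Ioo (le_max_right _ _) (min_le_right _ _))) h0'
    ⟨max_lt ht'.1 ht.1, lt_min ht'.2 ht.2⟩

/-- The flow line of a point at which the flow is defined up to time `t`. -/
theorem FlowDefined.exists_isMIntegralCurveOn
    (hY : ContMDiff J J.tangent ∞ (fun y => (⟨y, Y y⟩ : TangentBundle J P)))
    {t : ℝ} {y : P} (h : FlowDefined J Y t y) :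
    ∃ a b : ℝ, (0 : ℝ) ∈ Ioo a b ∧ t ∈ Ioo a b ∧ (∀ s ∈ Ioo a b, FlowDefined J Y s y) ∧
      IsMIntegralCurveOn (I := J) (fun s => localFlow J Y s y) Y (Ioo a b) := by
  obtain ⟨γ, rfl, a, b, h0, ht, hγ⟩ := h
  have key := fun s (hs : s ∈ Ioo a b) => localFlow_eq_of_isMIntegralCurveOn hY h0 hs hγ
  refine ⟨a, b, h0, ht, fun s hs => (key s hs).1, fun s hs => ?_⟩
  have h := (hγ s hs).congr_of_eventuallyEq
    (eventually_nhdsWithin_of_forall fun r hr => (key r hr).2) (key s hs).2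
  exact h.congr_mfderiv (congrArg (fun p => ((1 : ℝ →L[ℝ] ℝ).smulRight (Y p : E) : ℝ →L[ℝ] E))
    (key s hs).2.symm)

theorem localFlow_zero (hY : ContMDiff J J.tangent ∞ (fun y => (⟨y, Y y⟩ : TangentBundle J P)))
    (y : P) : localFlow J Y 0 y = y := by
  by_cases h : FlowDefined J Y 0 y
  · obtain ⟨γ, rfl, a, b, h0, ht, hγ⟩ := h
    exact (localFlow_eq_of_isMIntegralCurveOn hY h0 ht hγ).2
  -- where the flow is not defined, its junk value is `y` too
  · rw [localFlow, dif_neg h]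

/-- The group law of the local flow. -/
theorem localFlow_add (hY : ContMDiff J J.tangent ∞ (fun y => (⟨y, Y y⟩ : TangentBundle J P)))
    {s t : ℝ} {y : P} (hs : FlowDefined J Y s y) (ht : FlowDefined J Y t (localFlow J Y s y)) :
    FlowDefined J Y (s + t) y ∧ localFlow J Y (s + t) y = localFlow J Y t (localFlow J Y s y) := by
  obtain ⟨γ, rfl, a, b, h0, hsab, hγ⟩ := hs
  rw [(localFlow_eq_of_isMIntegralCurveOn hY h0 hsab hγ).2] at ht ⊢
  obtain ⟨γ', h0', a', b', hz', ht', hγ'⟩ := ht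
  have hlt := (localFlow_eq_of_isMIntegralCurveOn hY hz' ht' hγ').2
  rw [h0'] at hlt
  have hshift : IsMIntegralCurveOn (I := J) (γ' ∘ (· - s)) Y (Ioo (a' + s) (b' + s)) := by
    have h := (isMIntegralCurveOn_comp_sub (dt := s)).2 hγ'
    refine h.mono fun r hr => ?_
    simp only [mem_ofPred_eq, mem_Ioo] at hr ⊢
    exact ⟨by linarith [hr.1], by linarith [hr.2]⟩
  have hs2 : s ∈ Ioo a b ∩ Ioo (a' + s) (b' + s) :=
    ⟨hsab, by linarith [hz'.1], by linarith [hz'.2]⟩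
  have hag : γ s = (γ' ∘ (· - s)) s := by simp [h0']
  have hv := hY.of_le (show (1 : WithTop ℕ∞) ≤ ∞ by simp)
  -- the flow line of `γ 0` followed by the one of `γ s`
  have hglue := isMIntegralCurveOn_piecewise hv hγ hshift hs2 hag
  have heq := eqOn_piecewise_of_isMIntegralCurveOn_Ioo hv hγ hshift hs2 hag
  rw [Ioo_union_Ioo' (by linarith [hs2.1.1, hs2.2.2, hs2.1.2, hs2.2.1])
    (by linarith [hs2.1.1, hs2.2.2, hs2.1.2, hs2.2.1])] at hglue
  have hp0 : piecewise (Ioo a b) γ (γ' ∘ (· - s)) 0 = γ 0 := piecewise_eq_of_mem _ _ _ h0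
  have hpt : piecewise (Ioo a b) γ (γ' ∘ (· - s)) (s + t) = γ' t := by
    rw [heq ⟨by linarith [ht'.1], by linarith [ht'.2]⟩]; simp
  have := localFlow_eq_of_isMIntegralCurveOn hY (t := s + t)
    ⟨(min_le_left _ _).trans_lt h0.1, h0.2.trans_le (le_max_left _ _)⟩
    ⟨(min_le_right _ _).trans_lt (by linarith [ht'.1]),
      lt_of_lt_of_le (by linarith [ht'.2]) (le_max_right _ _)⟩ hglue
  rw [hp0, hpt] at this
  exact ⟨this.1, this.2.trans hlt.symm⟩

theorem localFlow_neg (hY : ContMDiff J J.tangent ∞ (fun y => (⟨y, Y y⟩ : TangentBundle J P)))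
    {t : ℝ} {y : P} (h : FlowDefined J Y t y) :
    FlowDefined J Y (-t) (localFlow J Y t y) ∧
      localFlow J Y (-t) (localFlow J Y t y) = y := by
  obtain ⟨γ, rfl, a, b, h0, ht, hγ⟩ := h
  rw [(localFlow_eq_of_isMIntegralCurveOn hY h0 ht hγ).2]
  have hshift : IsMIntegralCurveOn (I := J) (γ ∘ (· + t)) Y (Ioo (a - t) (b - t)) := by
    have h := hγ.comp_add t
    refine h.mono fun r hr => ?_
    simp only [mem_ofPred_eq, mem_Ioo] at hr ⊢
    exact ⟨by linarith [hr.1], by linarith [hr.2]⟩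
  have := localFlow_eq_of_isMIntegralCurveOn hY (t := -t)
    ⟨by linarith [ht.1], by linarith [ht.2]⟩ ⟨by linarith [h0.1], by linarith [h0.2]⟩ hshift
  simpa using this

/-- The local flow near a point, in the chart at the point: it is differentiable, and its derivative
at the base point is given by a solution of the variational equation. -/
theorem exists_localFlow_chart [CompleteSpace E]
    (hY : ContMDiff J J.tangent ∞ (fun y => (⟨y, Y y⟩ : TangentBundle J P))) (y₀ : P) :
    ∃ (f : ℝ → E) (S : ℝ → E →L[ℝ] E), ∃ ε > (0 : ℝ),
      f 0 = extChartAt J y₀ y₀ ∧ S 0 = ContinuousLinearMap.id ℝ E ∧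
      HasDerivAt f (chartField J y₀ Y (extChartAt J y₀ y₀)) 0 ∧
      HasDerivAt S (fderiv ℝ (chartField J y₀ Y) (extChartAt J y₀ y₀)) 0 ∧
      (∀ t ∈ Ioo (-ε) ε, f t ∈ (extChartAt J y₀).target ∧
        localFlow J Y t y₀ = (extChartAt J y₀).symm (f t) ∧
        modelDeriv J J (localFlow J Y t) y₀
          = (modelDeriv 𝓘(ℝ, E) J (extChartAt J y₀).symm (f t)).comp
            ((S t).comp (modelDeriv J 𝓘(ℝ, E) (extChartAt J y₀) y₀))) ∧
      ∀ᶠ y in 𝓝 y₀, ∀ t ∈ Ioo (-ε) ε,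
        FlowDefined J Y t y ∧ MDifferentiableAt J J (localFlow J Y t) y := by
  have hv : ContDiffAt ℝ (2 : ℕ∞) (chartField J y₀ Y) (extChartAt J y₀ y₀) :=
    contMDiffAt_iff_chartField.1 ((hY y₀).of_le (by exact_mod_cast le_top))
  obtain ⟨f, S, ρ, hρ, ε, hε, hfS⟩ := ContDiffAt.exists_local_flow_hasFDerivAt
    (by exact_mod_cast hv)
    ((isOpen_extChartAt_target y₀).mem_nhds (mem_extChartAt_target (I := J) y₀))
  have hflow : ∀ y ∈ (extChartAt J y₀).source,
      extChartAt J y₀ y ∈ Metric.ball (extChartAt J y₀ y₀) ρ →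
      ∀ t ∈ Ioo (-ε) ε, FlowDefined J Y t y ∧
        localFlow J Y t y = (extChartAt J y₀).symm (f (extChartAt J y₀ y) t) := by
    intro y hy hyb t ht
    obtain ⟨h0, -, -, hd⟩ := hfS _ hyb
    have hint : IsMIntegralCurveOn (I := J)
        (fun s => (extChartAt J y₀).symm (f (extChartAt J y₀ y) s)) Y (Ioo (-ε) ε) := fun s hs =>
      (hasMFDerivAt_extChartAt_symm_comp (hd s hs).2.1 (hd s hs).1).hasMFDerivWithinAt
    have := localFlow_eq_of_isMIntegralCurveOn hY (t := t) ⟨by linarith, hε⟩ ht hint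
    simpa only [h0, (extChartAt J y₀).left_inv hy] using this
  have hopen : IsOpen ((extChartAt J y₀).source ∩
      extChartAt J y₀ ⁻¹' Metric.ball (extChartAt J y₀ y₀) ρ) :=
    (continuousOn_extChartAt y₀).isOpen_inter_preimage (isOpen_extChartAt_source y₀)
      Metric.isOpen_ball
  have hmem₀ : y₀ ∈ (extChartAt J y₀).source ∩
      extChartAt J y₀ ⁻¹' Metric.ball (extChartAt J y₀ y₀) ρ :=
    ⟨mem_extChartAt_source y₀, Metric.mem_ball_self hρ⟩
  have hderiv : ∀ y ∈ (extChartAt J y₀).source ∩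
      extChartAt J y₀ ⁻¹' Metric.ball (extChartAt J y₀ y₀) ρ, ∀ t ∈ Ioo (-ε) ε,
      MDifferentiableAt J J (localFlow J Y t) y ∧
      modelDeriv J J (localFlow J Y t) y
        = (modelDeriv 𝓘(ℝ, E) J (extChartAt J y₀).symm (f (extChartAt J y₀ y) t)).comp
          ((S (extChartAt J y₀ y) t).comp (modelDeriv J 𝓘(ℝ, E) (extChartAt J y₀) y)) := by
    intro y hy t ht
    have hev : localFlow J Y t =ᶠ[𝓝 y]
        fun w => (extChartAt J y₀).symm (f (extChartAt J y₀ w) t) := by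
      filter_upwards [hopen.mem_nhds hy] with w hw using (hflow w hw.1 hw.2 t ht).2
    obtain ⟨-, -, -, hd⟩ := hfS _ hy.2
    have h1 := mdifferentiableAt_extChartAt_symm (hd t ht).2.1
    have h2 : HasMFDerivAt 𝓘(ℝ, E) 𝓘(ℝ, E) (fun w => f w t) (extChartAt J y₀ y)
        (S (extChartAt J y₀ y) t : E →L[ℝ] E) := (hd t ht).2.2.hasMFDerivAt
    have h3 := mdifferentiableAt_extChartAt_of_mem (J := J) hy.1
    have h23 : MDifferentiableAt J 𝓘(ℝ, E) (fun w => f (extChartAt J y₀ w) t) y :=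
      MDifferentiableAt.comp (g := fun w => f w t) y h2.mdifferentiableAt h3
    refine ⟨(MDifferentiableAt.comp y h1 h23).congr_of_eventuallyEq hev, ?_⟩
    rw [hev.modelDeriv_eq,
      modelDeriv_comp (f := fun w => f (extChartAt J y₀ w) t) (x := y) h1 h23,
      modelDeriv_comp (g := fun w => f w t) h2.mdifferentiableAt h3, modelDeriv_eq_fderiv,
      (hd t ht).2.2.fderiv]
  obtain ⟨h0, hS0, hS, hd⟩ := hfS _ (Metric.mem_ball_self hρ)
  refine ⟨f (extChartAt J y₀ y₀), S (extChartAt J y₀ y₀), ε, hε, h0, hS0, ?_, hS,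
    fun t ht => ⟨(hd t ht).2.1, (hflow y₀ hmem₀.1 hmem₀.2 t ht).2, (hderiv y₀ hmem₀ t ht).2⟩, ?_⟩
  · have := (hd 0 ⟨by linarith, hε⟩).1
    rwa [h0] at this
  · filter_upwards [hopen.mem_nhds hmem₀] with y hy t ht
    exact ⟨(hflow y hy.1 hy.2 t ht).1, (hderiv y hy t ht).1⟩

end LocalFlow

/-! ### The derivative of local flows and Cartan's formula -/

section LocalFlowDeriv

open Set Filter

variable {E H : Type*} [NormedAddCommGroup E] [NormedSpace ℝ E] [TopologicalSpace H]
  {J : ModelWithCorners ℝ E H} [J.Boundaryless] {P : Type*} [TopologicalSpace P]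
  [ChartedSpace H P] [IsManifold J ∞ P] [T2Space P]
  {Y : ∀ y : P, TangentSpace J y}

/-- Concatenation of two differentiable pieces of the local flow. -/
theorem localFlow_add_of_eventually
    (hY : ContMDiff J J.tangent ∞ (fun y => (⟨y, Y y⟩ : TangentBundle J P)))
    {s t : ℝ} {y : P} (hs : ∀ᶠ z in 𝓝 y, FlowDefined J Y s z)
    (hsd : MDifferentiableAt J J (localFlow J Y s) y)
    (ht : ∀ᶠ z in 𝓝 (localFlow J Y s y), FlowDefined J Y t z)
    (htd : MDifferentiableAt J J (localFlow J Y t) (localFlow J Y s y)) :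
    (∀ᶠ z in 𝓝 y, FlowDefined J Y (s + t) z) ∧
      MDifferentiableAt J J (localFlow J Y (s + t)) y ∧
      modelDeriv J J (localFlow J Y (s + t)) y
        = (modelDeriv J J (localFlow J Y t) (localFlow J Y s y)).comp
            (modelDeriv J J (localFlow J Y s) y) := by
  have ht' := hsd.continuousAt.eventually ht
  have hev : localFlow J Y (s + t) =ᶠ[𝓝 y] fun z => localFlow J Y t (localFlow J Y s z) := by
    filter_upwards [hs, ht'] with z h1 h2 using (localFlow_add hY h1 h2).2
  refine ⟨?_, (MDifferentiableAt.comp y htd hsd).congr_of_eventuallyEq hev, ?_⟩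
  · filter_upwards [hs, ht'] with z h1 h2 using (localFlow_add hY h1 h2).1
  · rw [hev.modelDeriv_eq, modelDeriv_comp htd hsd]

/-- The domain of the local flow is open, and the flow is differentiable on it. -/
theorem FlowDefined.eventually_and_mdifferentiableAt [CompleteSpace E]
    (hY : ContMDiff J J.tangent ∞ (fun y => (⟨y, Y y⟩ : TangentBundle J P)))
    {t : ℝ} {y : P} (h : FlowDefined J Y t y) :
    (∀ᶠ z in 𝓝 y, FlowDefined J Y t z) ∧ MDifferentiableAt J J (localFlow J Y t) y := by
  obtain ⟨a, b, h0, ht, -, hγ⟩ := h.exists_isMIntegralCurveOn hY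
  have h00 : (∀ᶠ z in 𝓝 y, FlowDefined J Y 0 z) ∧ MDifferentiableAt J J (localFlow J Y 0) y := by
    obtain ⟨-, -, ε, hε, -, -, -, -, -, hev⟩ := exists_localFlow_chart hY y
    exact ⟨hev.mono fun z hz => (hz 0 ⟨by linarith, hε⟩).1,
      (hev.self_of_nhds 0 ⟨by linarith, hε⟩).2⟩
  -- The set of times at which the claim holds is open and closed in the interval of the flow line:
  -- near any `s₀`, the flow at one time differs from the flow at another by a short-time flow
  -- near `localFlow J Y s₀ y`.
  refine isPreconnected_Ioo.induction₂'
    (fun s s' => ((∀ᶠ z in 𝓝 y, FlowDefined J Y s z) ∧ MDifferentiableAt J J (localFlow J Y s) y) →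
      ((∀ᶠ z in 𝓝 y, FlowDefined J Y s' z) ∧ MDifferentiableAt J J (localFlow J Y s') y))
    (fun s₀ hs₀ => ?_) (fun _ _ _ _ _ _ h1 h2 => h2 ∘ h1) h0 ht h00
  obtain ⟨-, -, ε, hε, -, -, -, -, -, hev⟩ := exists_localFlow_chart hY (localFlow J Y s₀ y)
  have hstep : ∀ s s', (∀ᶠ w in 𝓝 (localFlow J Y s y), ∀ t ∈ Ioo (-ε) ε,
      FlowDefined J Y t w ∧ MDifferentiableAt J J (localFlow J Y t) w) → |s' - s| < ε →
      ((∀ᶠ z in 𝓝 y, FlowDefined J Y s z) ∧ MDifferentiableAt J J (localFlow J Y s) y) →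
      ((∀ᶠ z in 𝓝 y, FlowDefined J Y s' z) ∧ MDifferentiableAt J J (localFlow J Y s') y) := by
    intro s s' hw hss hs
    have hmem : s' - s ∈ Ioo (-ε) ε := abs_lt.1 hss
    have := localFlow_add_of_eventually hY hs.1 hs.2 (hw.mono fun w hw => (hw _ hmem).1)
      (hw.self_of_nhds _ hmem).2
    rw [add_sub_cancel] at this
    exact ⟨this.1, this.2.1⟩
  have hc : ContinuousWithinAt (fun s => localFlow J Y s y) (Ioo a b) s₀ :=
    hγ.continuousWithinAt hs₀
  have hd : ∀ᶠ s in 𝓝[Ioo a b] s₀, |s - s₀| < ε :=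
    nhdsWithin_le_nhds ((Metric.ball_mem_nhds s₀ hε : ∀ᶠ s in 𝓝 s₀, dist s s₀ < ε))
  filter_upwards [hc.eventually (eventually_eventually_nhds.2 hev), hd] with s hs1 hs2
  exact ⟨hstep s₀ s hev hs2, hstep s s₀ hs1 (by rwa [abs_sub_comm])⟩

theorem modelDeriv_localFlow_add [CompleteSpace E]
    (hY : ContMDiff J J.tangent ∞ (fun y => (⟨y, Y y⟩ : TangentBundle J P)))
    {s t : ℝ} {y : P} (hs : FlowDefined J Y s y) (ht : FlowDefined J Y t (localFlow J Y s y)) :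
    modelDeriv J J (localFlow J Y (s + t)) y
        = (modelDeriv J J (localFlow J Y t) (localFlow J Y s y)).comp
            (modelDeriv J J (localFlow J Y s) y) := by
  have hs' := hs.eventually_and_mdifferentiableAt hY
  have ht' := ht.eventually_and_mdifferentiableAt hY
  exact (localFlow_add_of_eventually hY hs'.1 hs'.2 ht'.1 ht'.2).2.2

theorem modelDeriv_localFlow_zero [CompleteSpace E]
    (hY : ContMDiff J J.tangent ∞ (fun y => (⟨y, Y y⟩ : TangentBundle J P))) (y : P) :
    modelDeriv J J (localFlow J Y 0) y = ContinuousLinearMap.id ℝ E := by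
  rw [show localFlow J Y 0 = fun y => y from funext fun y => localFlow_zero hY y, modelDeriv_id]

/-- Every point has a flow line on some time interval around `0`. -/
theorem eventually_flowDefined [CompleteSpace E]
    (hY : ContMDiff J J.tangent ∞ (fun y => (⟨y, Y y⟩ : TangentBundle J P))) (y : P) :
    ∀ᶠ t in 𝓝 (0 : ℝ), FlowDefined J Y t y := by
  obtain ⟨-, -, ε, hε, -, -, -, -, -, hev⟩ := exists_localFlow_chart hY y
  filter_upwards [Ioo_mem_nhds (neg_lt_zero.2 hε) hε] with t ht using (hev.self_of_nhds t ht).1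

/-- Cartan's formula `L_Y η = ι_Y dη + d(η(Y))` for a `1`-form `η` with values in a normed space,
where `dη` is calculated in the chart at the point. -/
theorem hasDerivAt_localFlow_pullback [CompleteSpace E] {F : Type*} [NormedAddCommGroup F]
    [NormedSpace ℝ F]
    (hY : ContMDiff J J.tangent ∞ (fun y => (⟨y, Y y⟩ : TangentBundle J P)))
    (η : P → E →L[ℝ] F) (y : P) {ηc : E → E →L[ℝ] F}
    (hηc : ∀ z, ηc z = (η ((extChartAt J y).symm z)).comp
      (modelDeriv 𝓘(ℝ, E) J (extChartAt J y).symm z))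
    (hdiff : DifferentiableAt ℝ ηc (extChartAt J y y))
    (u : E) :
    HasDerivAt (fun t => η (localFlow J Y t y) (modelDeriv J J (localFlow J Y t) y u))
      (fderiv ℝ ηc (extChartAt J y y) (modelDeriv J 𝓘(ℝ, E) (extChartAt J y) y (Y y))
          (modelDeriv J 𝓘(ℝ, E) (extChartAt J y) y u)
        - fderiv ℝ ηc (extChartAt J y y) (modelDeriv J 𝓘(ℝ, E) (extChartAt J y) y u)
          (modelDeriv J 𝓘(ℝ, E) (extChartAt J y) y (Y y))
        + modelDeriv J 𝓘(ℝ, F) (fun y => η y (Y y)) y u) 0 := by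
  obtain ⟨f, S, ε, hε, hf0, hS0, hf, hS, hfl, -⟩ := exists_localFlow_chart hY y
  set z₀ := extChartAt J y y with hz₀
  set u' := modelDeriv J 𝓘(ℝ, E) (extChartAt J y) y u with hu'
  set v := chartField J y Y with hv
  have hz₀t : z₀ ∈ (extChartAt J y).target := mem_extChartAt_target y
  have hback : (extChartAt J y).symm z₀ = y := (extChartAt J y).left_inv (mem_extChartAt_source y)
  have hvz : v z₀ = modelDeriv J 𝓘(ℝ, E) (extChartAt J y) y (Y y) := by
    rw [hv]; simp only [chartField]; rw [hback]
  have hvd : DifferentiableAt ℝ v z₀ :=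
    ((contMDiffAt_iff_chartField (n := 1)).1
      ((hY y).of_le (by exact_mod_cast le_top))).differentiableAt (by simp)
  -- the derivative of the function `η(Y)`, in the chart
  have hd : modelDeriv J 𝓘(ℝ, F) (fun y => η y (Y y)) y u
      = fderiv ℝ ηc z₀ u' (v z₀) + ηc z₀ (fderiv ℝ v z₀ u') := by
    have h1 : (fun w => η w (Y w)) =ᶠ[𝓝 y]
        fun w => ηc (extChartAt J y w) (v (extChartAt J y w)) := by
      filter_upwards [extChartAt_source_mem_nhds (I := J) y] with w hw
      have hl := (extChartAt J y).left_inv hw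
      rw [hηc, hv]
      simp only [chartField, ContinuousLinearMap.comp_apply]
      rw [hl]
      exact congrArg (η w) (modelDeriv_symm_extChartAt hw _).symm
    have h2 := hdiff.hasFDerivAt.clm_apply hvd.hasFDerivAt
    rw [h1.modelDeriv_eq, modelDeriv_comp_apply (g := fun z => ηc z (v z)) (f := extChartAt J y)
      h2.hasMFDerivAt.mdifferentiableAt
      (mdifferentiableAt_extChartAt_of_mem (mem_extChartAt_source y)), modelDeriv_eq_fderiv,
      h2.fderiv]
    simp [hu', add_comm]
  -- in the chart the pull-back is `ηc (f t) ∘ S t`, and the product rule applies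
  have hfc : HasDerivAt (fun t => ηc (f t)) (fderiv ℝ ηc z₀ (v z₀)) 0 := by
    have : HasFDerivAt ηc (fderiv ℝ ηc z₀) (f 0) := by rw [hf0]; exact hdiff.hasFDerivAt
    exact this.comp_hasDerivAt 0 hf
  have hSu : HasDerivAt (fun t => S t u') (fderiv ℝ v z₀ u') 0 :=
    (hS.clm_apply (hasDerivAt_const 0 u')).congr_deriv (by simp)
  have hmain := hfc.clm_apply hSu
  have hEq : (fun t => η (localFlow J Y t y) (modelDeriv J J (localFlow J Y t) y u))
      =ᶠ[𝓝 0] fun t => ηc (f t) (S t u') := by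
    filter_upwards [Ioo_mem_nhds (neg_lt_zero.2 hε) hε] with t ht
    obtain ⟨-, h2, h3⟩ := hfl t ht
    rw [hηc, h3, h2]
    rfl
  refine (hmain.congr_of_eventuallyEq hEq).congr_deriv ?_
  rw [hd, hf0, hS0, ← hvz, ContinuousLinearMap.id_apply]
  abel

end LocalFlowDeriv

/-! ### The infinitesimal action -/

theorem op_smul_op_smul_eq_op_mul {K P : Type*} [Group K] [MulAction Kᵐᵒᵖ P] (y : P) (k l : K) :
    (y <• k) <• l = y <• (k * l) := by
  rw [MulOpposite.op_mul, mul_smul]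

namespace PrincipalBundle

variable {EK HK : Type*} [NormedAddCommGroup EK] [NormedSpace ℝ EK]
  [TopologicalSpace HK] {IK : ModelWithCorners ℝ EK HK}
  {K : Type*} [TopologicalSpace K] [ChartedSpace HK K] [Group K]
  {EM HM : Type*} [NormedAddCommGroup EM] [NormedSpace ℝ EM]
  [TopologicalSpace HM] {I : ModelWithCorners ℝ EM HM}
  {M : Type*} [TopologicalSpace M] [ChartedSpace HM M]
  {EP HP : Type*} [NormedAddCommGroup EP] [NormedSpace ℝ EP]
  [TopologicalSpace HP] {J : ModelWithCorners ℝ EP HP}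
  {P : Type*} [TopologicalSpace P] [ChartedSpace HP P]
  [MulAction Kᵐᵒᵖ P]
  (B : PrincipalBundle IK K I M J P)

theorem mdifferentiableAt_proj (y : P) : MDifferentiableAt J I B.proj y :=
  B.contMDiff_proj.mdifferentiable (by simp) y

theorem mdifferentiableAt_act_right (B : PrincipalBundle IK K I M J P) (k : K) (y : P) :
    MDifferentiableAt J J (fun z : P => z <• k) y :=
  MDifferentiableAt.comp (g := fun z : P × K => z.1 <• z.2) y (B.mdifferentiableAt_act y k)
    (mdifferentiableAt_id.prodMk mdifferentiableAt_const)

theorem modelDeriv_proj_act (k : K) (y : P) (u : EP) :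
    modelDeriv J I B.proj (y <• k) (modelDeriv J J (fun z : P => z <• k) y u)
      = modelDeriv J I B.proj y u := by
  rw [← modelDeriv_comp_apply (f := fun z : P => z <• k) (B.mdifferentiableAt_proj _)
    (B.mdifferentiableAt_act_right k y)]
  rw [show (fun z : P => B.proj (z <• k)) = B.proj from funext fun z => B.proj_act z k]

theorem modelDeriv_proj_fundamental (y : P) (a : EK) :
    modelDeriv J I B.proj y (modelDeriv IK J (fun g : K => y <• g) 1 a) = 0 :=
  B.proj_fundamentalMap y a

section LieGroup

variable [LieGroup IK ∞ K]

/-- Right translation by `k` maps the fundamental vector field of `a` to the one of `Ad(k⁻¹) a`. -/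
theorem modelDeriv_act_fundamental (B : PrincipalBundle IK K I M J P)
    (k : K) (y : P) (a : EK) :
    modelDeriv J J (fun z : P => z <• k) y (modelDeriv IK J (fun g : K => y <• g) 1 a)
      = modelDeriv IK J (fun g : K => (y <• k) <• g) 1 (adjointRep IK k⁻¹ a : EK) := by
  have h1 := modelDeriv_comp_apply (I₁ := IK) (I₂ := J) (I₃ := J) (g := fun z : P => z <• k)
    (f := fun g : K => y <• g) (x := 1) (B.mdifferentiableAt_act_right k _)
    (B.mdifferentiableAt_orbit y 1) a
  have h2 := modelDeriv_comp_apply (I₁ := IK) (I₂ := IK) (I₃ := J)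
    (g := fun g : K => (y <• k) <• g) (f := fun g : K => k⁻¹ * g * (k⁻¹)⁻¹) (x := 1)
    (B.mdifferentiableAt_orbit _ _) ((contMDiff_conj IK k⁻¹).mdifferentiable (by simp) _) a
  have h3 : (fun g : K => (y <• k) <• (k⁻¹ * g * (k⁻¹)⁻¹)) = fun g : K => (y <• g) <• k := by
    funext g
    simp only [op_smul_op_smul_eq_op_mul]
    congr 2; group
  rw [h3] at h2
  have e1 : y <• (1 : K) = y := by simp
  have e2 : k⁻¹ * 1 * (k⁻¹)⁻¹ = (1 : K) := by group
  rw [e1] at h1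
  rw [e2] at h2
  exact h1.symm.trans h2

/-- The derivative of the orbit map at `k` is the derivative at `1` of the orbit map of `y k`,
composed with left translation. -/
theorem modelDeriv_orbit (B : PrincipalBundle IK K I M J P)
    (k : K) (y : P) (a : EK) :
    modelDeriv IK J (fun g : K => y <• g) k (modelDeriv IK IK (fun g : K => k * g) 1 a)
      = modelDeriv IK J (fun g : K => (y <• k) <• g) 1 a := by
  have h := modelDeriv_comp_apply (I₁ := IK) (I₂ := IK) (I₃ := J)
    (g := fun g : K => y <• g) (f := fun g : K => k * g) (x := 1)
    (B.mdifferentiableAt_orbit _ _) ((contMDiff_mul_left (n := ∞)).mdifferentiable (by simp) _) a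
  simp only [mul_one] at h
  rw [← h]
  simp only [op_smul_op_smul_eq_op_mul]

/-! ### Equivariance of sections of the adjoint bundle -/

theorem adMk_equivariantMap (ν : ∀ x : M, B.AdFiber x) (y : P) :
    B.adMk y rfl (B.equivariantMap ν y) = ν (B.proj y) :=
  (B.existsUnique_adMk (ν (B.proj y)) y rfl).choose_spec.1

theorem adMk_injective {x : M} {y : P} {hy : B.proj y = x} {a b : GroupLieAlgebra IK K}
    (h : B.adMk y hy a = B.adMk y hy b) : a = b :=
  (B.existsUnique_adMk (B.adMk y hy b) y hy).unique h rfl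

theorem equivariantMap_eq (ν : ∀ x : M, B.AdFiber x) {x : M} {y : P} (hy : B.proj y = x)
    {a : GroupLieAlgebra IK K} (h : B.adMk y hy a = ν x) : B.equivariantMap ν y = a := by
  subst hy
  exact B.adMk_injective ((B.adMk_equivariantMap ν y).trans h.symm)

theorem equivariantMap_act (ν : ∀ x : M, B.AdFiber x) (y : P) (k : K) :
    B.equivariantMap ν (y <• k) = adjointRep IK k⁻¹ (B.equivariantMap ν y) := by
  refine B.equivariantMap_eq ν (B.proj_act y k) ?_
  rw [← B.adMk_equivariantMap ν y]
  exact (Quotient.sound (s := B.adSetoid (B.proj y)) ⟨k, rfl, rfl⟩).symm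

end LieGroup

/-- The adjoint representation as a continuous linear map of the model space. -/
noncomputable def adjointCLM (k : K) : EK →L[ℝ] EK :=
  modelDeriv IK IK (fun g : K => k * g * k⁻¹) 1

namespace Connection

variable {B} [IsManifold J ∞ P] (A : B.Connection)

/-! ### The connection form -/

theorem modelDeriv_proj_horLift (y : P) (v : TangentSpace I (B.proj y)) :
    modelDeriv J I B.proj y (A.horLift y v) = v :=
  (A.horEquiv y).apply_symm_apply v

variable [LieGroup IK ∞ K]

/-- The lift `X̃ + ξ^ν` of a vector field `X` with a section `ν` of the adjoint bundle. -/
noncomputable def liftField (X : ∀ x : M, TangentSpace I x) (ν : ∀ x : M, B.AdFiber x) (y : P) :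
    TangentSpace J y :=
  A.horField X y + B.verticalField (B.equivariantMap ν) y

theorem modelDeriv_proj_liftField (X : ∀ x : M, TangentSpace I x) (ν : ∀ x : M, B.AdFiber x)
    (y : P) : modelDeriv J I B.proj y (A.liftField X ν y) = X (B.proj y) := by
  refine (map_add (modelDeriv J I B.proj y) (A.horField X y : EP)
    (B.verticalField (B.equivariantMap ν) y : EP)).trans ?_
  refine (congrArg₂ (· + ·) (A.modelDeriv_proj_horLift y _)
    (B.modelDeriv_proj_fundamental y (B.equivariantMap ν y))).trans ?_
  exact add_zero (X (B.proj y) : EM)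

variable [FiniteDimensional ℝ EP]

/-- The connection form, as a linear map of the model vector spaces. -/
noncomputable def form (y : P) : EP →L[ℝ] EK := A.connForm y

theorem form_fundamental (y : P) (a : EK) :
    A.form y (modelDeriv IK J (fun g : K => y <• g) 1 a) = a := by
  have h1 := Submodule.projectionOnto_apply_left (A.isCompl y)
    ⟨B.fundamentalMap y a, B.proj_fundamentalMap y a⟩
  have h2 : A.connForm y (B.fundamentalMap y a) = (B.verticalEquiv y).symm
      (Submodule.projectionOnto _ _ (A.isCompl y) (B.fundamentalMap y a)) := rfl
  refine h2.trans ?_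
  rw [h1]
  exact (B.verticalEquiv y).symm_apply_apply a

theorem form_eq_zero_iff (y : P) (u : EP) :
    A.form y u = 0 ↔ (show TangentSpace J y from u) ∈ A.hor y := by
  have h2 : A.connForm y u = (B.verticalEquiv y).symm
      (Submodule.projectionOnto _ _ (A.isCompl y) u) := rfl
  have h3 : A.form y u = 0 ↔ A.connForm y u = 0 := Iff.rfl
  rw [h3, h2, LinearEquiv.map_eq_zero_iff]
  exact Submodule.projectionOnto_apply_eq_zero_iff (A.isCompl y)

theorem eq_zero_of_form_eq_zero {y : P} {u : EP} (h1 : modelDeriv J I B.proj y u = 0)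
    (h2 : A.form y u = 0) : u = 0 := by
  have := (A.isCompl y).disjoint.le_bot ⟨(h1 : u ∈ LinearMap.ker _), (A.form_eq_zero_iff y u).1 h2⟩
  exact this

/-- A tangent vector of `P` is determined by its projection to `M` and its value under `ω`. -/
theorem eq_of_form_eq {y : P} {u u' : EP}
    (h1 : modelDeriv J I B.proj y u = modelDeriv J I B.proj y u')
    (h2 : A.form y u = A.form y u') : u = u' :=
  sub_eq_zero.1 (A.eq_zero_of_form_eq_zero (by rw [map_sub, h1, sub_self])
    (by rw [map_sub, h2, sub_self]))

/-- The connection form is equivariant: `R_k^* ω = Ad(k⁻¹) ω`. -/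
theorem form_act (k : K) (y : P) (u : EP) :
    A.form (y <• k) (modelDeriv J J (fun z : P => z <• k) y u)
      = adjointCLM (IK := IK) k⁻¹ (A.form y u) := by
  -- split `u` into its horizontal part `h` and the vertical vector `a^#`
  set a := A.form y u with ha
  set h := u - modelDeriv IK J (fun g : K => y <• g) 1 a with hh
  have hu : u = h + modelDeriv IK J (fun g : K => y <• g) 1 a := by rw [hh]; abel
  have h0 : A.form y h = 0 := by rw [hh, map_sub, A.form_fundamental, ← ha, sub_self]
  have h1 : A.form (y <• k) (modelDeriv J J (fun z : P => z <• k) y h) = 0 := by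
    rw [A.form_eq_zero_iff, ← A.map_act y k]
    exact Submodule.mem_map_of_mem ((A.form_eq_zero_iff y h).1 h0)
  conv_lhs => rw [hu, map_add, map_add, h1, zero_add, B.modelDeriv_act_fundamental]
  exact A.form_fundamental (y <• k) _

theorem form_horLift (y : P) (v : TangentSpace I (B.proj y)) : A.form y (A.horLift y v) = 0 :=
  (A.form_eq_zero_iff y _).2 ((A.horEquiv y).symm v).2

theorem form_liftField (X : ∀ x : M, TangentSpace I x) (ν : ∀ x : M, B.AdFiber x)
    (y : P) : A.form y (A.liftField X ν y) = B.equivariantMap ν y := by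
  refine (map_add (A.form y) (A.horField X y : EP)
    (B.verticalField (B.equivariantMap ν) y : EP)).trans ?_
  refine (congrArg₂ (fun a b : EK => a + b) (A.form_horLift y _)
    (A.form_fundamental y (B.equivariantMap ν y))).trans ?_
  exact zero_add (show EK from B.equivariantMap ν y)

/-- The lift `X̃ + ξ^ν` is invariant under the structure group. -/
theorem modelDeriv_act_liftField (X : ∀ x : M, TangentSpace I x) (ν : ∀ x : M, B.AdFiber x)
    (k : K) (y : P) :
    modelDeriv J J (fun z : P => z <• k) y (A.liftField X ν y) = A.liftField X ν (y <• k) := by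
  refine A.eq_of_form_eq (y := y <• k) ?_ ?_
  · refine (B.modelDeriv_proj_act k y _).trans ?_
    refine (A.modelDeriv_proj_liftField X ν y).trans
      (Eq.trans ?_ (A.modelDeriv_proj_liftField X ν (y <• k)).symm)
    exact congrArg (fun x => (X x : EM)) (B.proj_act y k).symm
  · refine (A.form_act k y _).trans ?_
    refine Eq.trans ?_ (A.form_liftField X ν (y <• k)).symm
    refine (congrArg _ (A.form_liftField X ν y)).trans ?_
    exact (B.equivariantMap_act ν y k).symm

end Connection

end PrincipalBundle

/-! ### Smoothness of the connection form and of the lifted vector field -/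

section Inverse

variable {E V W : Type*} [NormedAddCommGroup E] [NormedSpace ℝ E]
  [NormedAddCommGroup V] [NormedSpace ℝ V] [FiniteDimensional ℝ V]
  [NormedAddCommGroup W] [NormedSpace ℝ W]

/-- The inverse of a smooth family of linear maps is smooth where the map is bijective. -/
theorem ContDiffAt.exists_inverse_of_bijective {T : E → V →L[ℝ] W} {z₀ : E} {n : WithTop ℕ∞}
    (hT : ContDiffAt ℝ n T z₀) (hb : Function.Bijective (T z₀)) :
    ∃ S : E → W →L[ℝ] V, ContDiffAt ℝ n S z₀ ∧
      ∀ᶠ z in 𝓝 z₀, (∀ w, T z (S z w) = w) ∧ ∀ v, S z (T z v) = v := by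
  let e : V ≃L[ℝ] W :=
    { (LinearEquiv.ofBijective (T z₀).toLinearMap hb) with
      continuous_toFun := (T z₀).continuous
      continuous_invFun := by
        have : FiniteDimensional ℝ W :=
          Module.Finite.equiv (LinearEquiv.ofBijective (T z₀).toLinearMap hb)
        exact LinearMap.continuous_of_finiteDimensional
          (LinearEquiv.ofBijective (T z₀).toLinearMap hb).symm.toLinearMap }
  have he : (e : V →L[ℝ] W) = T z₀ := by ext; rfl
  have : CompleteSpace V := FiniteDimensional.complete ℝ V
  have hinv : ContDiffAt ℝ n (ContinuousLinearMap.inverse : (V →L[ℝ] W) → W →L[ℝ] V) (T z₀) := by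
    rw [← he]; exact contDiffAt_map_inverse e
  refine ⟨fun z => (T z).inverse, ContDiffAt.comp z₀ hinv hT, ?_⟩
  have hnhds : Set.range ((↑) : (V ≃L[ℝ] W) → V →L[ℝ] W) ∈ 𝓝 (T z₀) := by
    rw [← he]; exact ContinuousLinearEquiv.nhds e
  filter_upwards [hT.continuousAt hnhds] with z ⟨f, hf⟩
  rw [← hf, ContinuousLinearMap.inverse_equiv]
  simp

end Inverse

namespace PrincipalBundle

variable {EK HK : Type*} [NormedAddCommGroup EK] [NormedSpace ℝ EK]
  [TopologicalSpace HK] {IK : ModelWithCorners ℝ EK HK}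
  {K : Type*} [TopologicalSpace K] [ChartedSpace HK K] [Group K] [LieGroup IK ∞ K]
  {EM HM : Type*} [NormedAddCommGroup EM] [NormedSpace ℝ EM]
  [TopologicalSpace HM] {I : ModelWithCorners ℝ EM HM}
  {M : Type*} [TopologicalSpace M] [ChartedSpace HM M]
  {EP HP : Type*} [NormedAddCommGroup EP] [NormedSpace ℝ EP]
  [TopologicalSpace HP] {J : ModelWithCorners ℝ EP HP}
  {P : Type*} [TopologicalSpace P] [ChartedSpace HP P] [IsManifold J ∞ P]
  [MulAction Kᵐᵒᵖ P]

/-- The fundamental vector field of an element of the Lie algebra is smooth: it is the composition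
of the derivative of the action with the smooth map `y ↦ ((y, 0), (1, a))`. -/
theorem contMDiff_fundamental (B : PrincipalBundle IK K I M J P) (a : EK) :
    ContMDiff J J.tangent ∞ (fun y : P =>
      (⟨y, (modelDeriv IK J (fun k : K => y <• k) 1 a : EP)⟩ : TangentBundle J P)) := by
  have : IsManifold IK ∞ K := LieGroup.toContMDiffMul.toIsManifold
  have h1 : ContMDiff J J.tangent ∞ (fun y : P => (⟨y, (0 : EP)⟩ : TangentBundle J P)) :=
    Bundle.contMDiff_zeroSection ℝ (TangentSpace J)
  have h2 : ContMDiff J IK.tangent ∞ (fun _ : P => (⟨(1 : K), (a : EK)⟩ : TangentBundle IK K)) :=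
    contMDiff_const
  have h3 : ContMDiff (J.tangent.prod IK.tangent) (J.prod IK).tangent ∞
      (equivTangentBundleProd J P IK K).symm := contMDiff_equivTangentBundleProd_symm
  have h4 : ContMDiff (J.prod IK).tangent J.tangent ∞
      (tangentMap (J.prod IK) J (fun z : P × K => z.1 <• z.2)) :=
    B.contMDiff_act.contMDiff_tangentMap (by simp)
  have h5 := (h4.comp h3).comp (h1.prodMk h2)
  convert! h5 using 1
  funext y
  have h6 := modelDeriv_prod_apply (I₁ := J) (I₂ := IK) (I₃ := J) (p := (y, (1 : K)))
    (B.mdifferentiableAt_act y 1) 0 a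
  rw [map_zero, zero_add] at h6
  have e1 : y <• (1 : K) = y := by simp
  refine Eq.trans ?_ (congrArg (fun u : EP => (⟨y <• (1 : K), u⟩ : TangentBundle J P)) h6.symm)
  have key : ∀ (p q : P) (u : EP), p = q → (⟨p, u⟩ : TangentBundle J P) = ⟨q, u⟩ := by
    rintro p _ u rfl; rfl
  exact key _ _ _ e1.symm

namespace Connection

variable [FiniteDimensional ℝ EP] [J.Boundaryless]
  {B : PrincipalBundle IK K I M J P} (A : B.Connection)

theorem connFormInChart_chartField (Y : P → EP) (y₀ : P) {z : EP}
    (hz : z ∈ (extChartAt J y₀).target) :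
    A.connFormInChart y₀ z (chartField J y₀ Y z)
      = A.form ((extChartAt J y₀).symm z) (Y ((extChartAt J y₀).symm z)) :=
  congrArg (A.form ((extChartAt J y₀).symm z)) (modelDeriv_symm_extChartAt_symm hz _)

/-- A smooth local frame of the horizontal distribution. -/
theorem exists_horizontal_frame (y₀ : P) :
    ∃ (U : Set P) (Z : Fin (Module.finrank ℝ EM) → P → EP), IsOpen U ∧ y₀ ∈ U ∧
      (∀ i, ContDiffAt ℝ ∞ (chartField J y₀ (Z i)) (extChartAt J y₀ y₀)) ∧
      ∀ y ∈ U, LinearIndependent ℝ (fun i => Z i y) ∧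
        ∀ u : EP, A.form y u = 0 ↔ ∃ c : Fin (Module.finrank ℝ EM) → ℝ, ∑ i, c i • Z i y = u := by
  obtain ⟨U, Z, hU, hyU, hZs, hZ⟩ := A.smooth y₀
  refine ⟨U, Z, hU, hyU, fun i => (contMDiffAt_iff_chartField (n := ⊤)).1
    ((hZs i).contMDiffAt (hU.mem_nhds hyU)), fun y hy => ⟨(hZ y hy).1, fun u => ?_⟩⟩
  rw [A.form_eq_zero_iff, ← (hZ y hy).2]
  exact Submodule.mem_span_range_iff_exists_fun ℝ

variable [FiniteDimensional ℝ EK]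

/-- The connection form is smooth. In terms of a local frame `Z` of the horizontal distribution it
is the second component of the inverse of the isomorphism `(c, a) ↦ ∑ cᵢ Zᵢ + a^#`. -/
theorem contDiffAt_connFormInChart (y₀ : P) :
    ContDiffAt ℝ ∞ (A.connFormInChart y₀) (extChartAt J y₀ y₀) := by
  obtain ⟨U, Z, hU, hyU, hZc, hZ⟩ := A.exists_horizontal_frame y₀
  set z₀ := extChartAt J y₀ y₀ with hz₀
  have hz₀t : z₀ ∈ (extChartAt J y₀).target := mem_extChartAt_target y₀
  have hback : (extChartAt J y₀).symm z₀ = y₀ :=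
    (extChartAt J y₀).left_inv (mem_extChartAt_source y₀)
  let fund : EK → P → EP := fun a y => modelDeriv IK J (fun k : K => y <• k) 1 a
  have hFc : ∀ a, ContDiffAt ℝ ∞ (chartField J y₀ (fund a)) z₀ := fun a =>
    (contMDiffAt_iff_chartField (n := ⊤)).1 ((B.contMDiff_fundamental a) y₀)
  let b := Module.finBasis ℝ EK
  let n := Module.finrank ℝ EM
  -- the map `(c, a) ↦ ∑ cᵢ Zᵢ + a^#`, in the chart
  let T : EP → ((Fin n → ℝ) × EK) →L[ℝ] EP := fun z =>
    (∑ i, ((ContinuousLinearMap.proj i).comp (ContinuousLinearMap.fst ℝ (Fin n → ℝ) EK)).smulRight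
      (chartField J y₀ (Z i) z))
    + ∑ j, ((LinearMap.toContinuousLinearMap (b.coord j)).comp
        (ContinuousLinearMap.snd ℝ (Fin n → ℝ) EK)).smulRight (chartField J y₀ (fund (b j)) z)
  have hTs : ContDiffAt ℝ ∞ T z₀ :=
    (ContDiffAt.sum fun i _ => contDiffAt_const.smulRight (hZc i)).add
      (ContDiffAt.sum fun j _ => contDiffAt_const.smulRight (hFc (b j)))
  have hTapp : ∀ z c a, T z (c, a) = ∑ i, c i • chartField J y₀ (Z i) z
      + chartField J y₀ (fund a) z := by
    intro z c a
    have : chartField J y₀ (fund a) z = ∑ j, b.repr a j • chartField J y₀ (fund (b j)) z := by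
      simp only [chartField, fund]
      conv_lhs => rw [← b.sum_repr a]
      simp only [map_sum, map_smul]
    rw [this]
    simp [T]
  have hωT : ∀ z ∈ (extChartAt J y₀).target, (extChartAt J y₀).symm z ∈ U → ∀ p,
      A.connFormInChart y₀ z (T z p) = p.2 := by
    rintro z hz hzU ⟨c, a⟩
    rw [hTapp, map_add, map_sum, A.connFormInChart_chartField (fund a) y₀ hz]
    have h0 : ∀ i, A.connFormInChart y₀ z (chartField J y₀ (Z i) z) = 0 := fun i =>
      (A.connFormInChart_chartField (Z i) y₀ hz).trans
        (((hZ _ hzU).2 _).2 ⟨Pi.single i 1, by simp [Pi.single_apply]⟩)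
    simp only [map_smul, h0, smul_zero, Finset.sum_const_zero, zero_add]
    exact A.form_fundamental _ a
  have hb : Function.Bijective (T z₀) := by
    constructor
    · rw [injective_iff_map_eq_zero]
      rintro ⟨c, a⟩ hca
      have ha : a = 0 := by
        have := hωT z₀ hz₀t (by rwa [hback]) (c, a)
        rw [hca, map_zero] at this
        exact this.symm
      subst ha
      rw [hTapp] at hca
      have hli := (hZ y₀ hyU).1
      rw [Fintype.linearIndependent_iff] at hli
      have hsum : ∑ i, c i • Z i y₀ = 0 := by
        have h1 := congrArg (modelDeriv 𝓘(ℝ, EP) J (extChartAt J y₀).symm z₀) hca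
        simp only [chartField, map_sum, map_smul, fund, map_zero, add_zero,
          modelDeriv_symm_extChartAt_symm hz₀t] at h1
        simpa only [hback] using h1
      have := hli c hsum
      ext i
      · exact this i
      · rfl
    · intro w
      set u := modelDeriv 𝓘(ℝ, EP) J (extChartAt J y₀).symm z₀ w with hu
      obtain ⟨c, hc⟩ := ((hZ y₀ hyU).2 (u - fund (A.form y₀ u) y₀)).1
        ((map_sub _ _ _).trans (sub_eq_zero.2 (A.form_fundamental y₀ _).symm))
      refine ⟨(c, A.form y₀ u), ?_⟩
      rw [hTapp]
      -- at `z₀` the field in the chart is the image of `Y y₀` under the derivative of the chart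
      have h1 : ∀ Y : P → EP, chartField J y₀ Y z₀
          = modelDeriv J 𝓘(ℝ, EP) (extChartAt J y₀) y₀ (Y y₀) := by
        intro Y; simp only [chartField, hback]
      simp only [h1, ← map_smul, ← map_sum]
      rw [hc, ← map_add, sub_add_cancel, hu]
      have := modelDeriv_extChartAt_symm hz₀t w
      rwa [hback] at this
  obtain ⟨S, hS, hST⟩ := hTs.exists_inverse_of_bijective hb
  have hev : A.connFormInChart y₀ =ᶠ[𝓝 z₀]
      fun z => (ContinuousLinearMap.snd ℝ (Fin n → ℝ) EK).comp (S z) := by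
    have hcU : ∀ᶠ z in 𝓝 z₀, (extChartAt J y₀).symm z ∈ U :=
      (continuousAt_extChartAt_symm y₀).eventually (by rw [hback]; exact hU.mem_nhds hyU)
    filter_upwards [hST, hcU, (isOpen_extChartAt_target y₀).mem_nhds hz₀t] with z h1 h2 h3
    ext w
    have := hωT z h3 h2 (S z w)
    rw [h1.1 w] at this
    exact this
  exact (contDiffAt_const.clm_comp hS).congr_of_eventuallyEq hev

variable [I.Boundaryless] [IsManifold I ∞ M]

/-- The lift `X̃ + ξ^ν` is smooth. In a chart it is the preimage of `(X, ν̂)` under the isomorphism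
`(dp, ω)`. -/
theorem contMDiff_liftField {X : ∀ x : M, TangentSpace I x}
    (hX : ContMDiff I I.tangent ∞ (fun x => (⟨x, X x⟩ : TangentBundle I M))) (ν : B.AdSection) :
    ContMDiff J J.tangent ∞
      (fun y => (⟨y, A.liftField X ν.toFun y⟩ : TangentBundle J P)) := by
  intro y₀
  refine (contMDiffAt_iff_chartField (n := ⊤)).2 ?_
  set Ψ := (extChartAt J y₀).symm with hΨ
  set z₀ := extChartAt J y₀ y₀ with hz₀
  set x₀ := B.proj y₀ with hx₀
  have hz₀t : z₀ ∈ (extChartAt J y₀).target := mem_extChartAt_target y₀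
  have hback : Ψ z₀ = y₀ := (extChartAt J y₀).left_inv (mem_extChartAt_source y₀)
  set pc : EP → EM := fun z => extChartAt I x₀ (B.proj (Ψ z)) with hpc
  have hΨs : ContMDiffAt 𝓘(ℝ, EP) J ∞ Ψ z₀ := contMDiffAt_extChartAt_symm hz₀t
  have hpcs : ContDiffAt ℝ ∞ pc z₀ := by
    rw [← contMDiffAt_iff_contDiffAt]
    have h1 : ContMDiffAt 𝓘(ℝ, EP) I ∞ (fun z => B.proj (Ψ z)) z₀ :=
      B.contMDiff_proj.contMDiffAt.comp z₀ hΨs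
    refine ContMDiffAt.comp (g := extChartAt I x₀) z₀ ?_ h1
    rw [hback]
    exact contMDiffAt_extChartAt
  have hsrc : ∀ᶠ z in 𝓝 z₀, B.proj (Ψ z) ∈ (extChartAt I x₀).source := by
    have hc : ContinuousAt (fun z => B.proj (Ψ z)) z₀ :=
      B.contMDiff_proj.continuous.continuousAt.comp hΨs.continuousAt
    refine hc.eventually ?_
    simp only [hback]
    exact extChartAt_source_mem_nhds x₀
  have htgt := (isOpen_extChartAt_target y₀).mem_nhds hz₀t
  have hpcd : ∀ z ∈ (extChartAt J y₀).target, B.proj (Ψ z) ∈ (extChartAt I x₀).source → ∀ w,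
      fderiv ℝ pc z w = modelDeriv I 𝓘(ℝ, EM) (extChartAt I x₀) (B.proj (Ψ z))
        (modelDeriv J I B.proj (Ψ z) (modelDeriv 𝓘(ℝ, EP) J Ψ z w)) := by
    intro z hz hs w
    have h1 := mdifferentiableAt_extChartAt_symm hz
    have h2 := B.mdifferentiableAt_proj (Ψ z)
    rw [← modelDeriv_eq_fderiv, hpc,
      modelDeriv_comp_apply (f := fun z => B.proj (Ψ z)) (mdifferentiableAt_extChartAt_of_mem hs)
        (MDifferentiableAt.comp z h2 h1), modelDeriv_comp_apply h2 h1]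
  -- the map `(dp, ω)`, in the charts
  let T : EP → EP →L[ℝ] EM × EK := fun z => (fderiv ℝ pc z).prod (A.connFormInChart y₀ z)
  have hTs : ContDiffAt ℝ ∞ T z₀ :=
    ContDiffAt.comp z₀
      (ContinuousLinearMap.prodₗᵢ ℝ (𝕜 := ℝ) (E := EP) (F := EM) (G := EK)).contDiff.contDiffAt
      ((hpcs.fderiv_right (m := ∞) le_rfl).prodMk (A.contDiffAt_connFormInChart y₀))
  have hform : ∀ z w, A.connFormInChart y₀ z w = A.form (Ψ z) (modelDeriv 𝓘(ℝ, EP) J Ψ z w) :=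
    fun _ _ => rfl
  have hs₀ : B.proj (Ψ z₀) ∈ (extChartAt I x₀).source := hsrc.self_of_nhds
  have hb : Function.Bijective (T z₀) := by
    constructor
    · rw [injective_iff_map_eq_zero]
      intro w hw
      obtain ⟨h1, h2⟩ := Prod.mk.inj hw
      rw [ContinuousLinearMap.coe_coe, hpcd z₀ hz₀t hs₀] at h1
      have h3 : modelDeriv J I B.proj (Ψ z₀) (modelDeriv 𝓘(ℝ, EP) J Ψ z₀ w) = 0 := by
        rw [← modelDeriv_symm_extChartAt hs₀ (modelDeriv J I B.proj (Ψ z₀) _), h1, map_zero]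
      have h4 := A.eq_zero_of_form_eq_zero h3 h2
      rw [← modelDeriv_extChartAt_symm hz₀t w, h4, map_zero]
    · rintro ⟨m, a⟩
      obtain ⟨u, hu⟩ : ∃ u : EP, modelDeriv J I B.proj (Ψ z₀) u =
          modelDeriv 𝓘(ℝ, EM) I (extChartAt I x₀).symm (extChartAt I x₀ (B.proj (Ψ z₀))) m :=
        B.mfderiv_proj_surjective (Ψ z₀) _
      -- correct the vertical part of a vector `u` over `m`
      set u' : EP := u + modelDeriv IK J (fun k : K => Ψ z₀ <• k) 1 (a - A.form (Ψ z₀) u) with hu''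
      have hm : modelDeriv 𝓘(ℝ, EP) J Ψ z₀
          (modelDeriv J 𝓘(ℝ, EP) (extChartAt J y₀) (Ψ z₀) u') = u' :=
        modelDeriv_symm_extChartAt_symm hz₀t u'
      refine ⟨modelDeriv J 𝓘(ℝ, EP) (extChartAt J y₀) (Ψ z₀) u', Prod.ext ?_ ?_⟩
      · refine (hpcd z₀ hz₀t hs₀ _).trans ?_
        rw [hm, hu'', map_add, B.modelDeriv_proj_fundamental, add_zero, hu]
        have := modelDeriv_extChartAt_symm ((extChartAt I x₀).map_source hs₀) m
        rwa [(extChartAt I x₀).left_inv hs₀] at this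
      · refine (hform _ _).trans ?_
        rw [hm, hu'', map_add, A.form_fundamental]
        exact add_sub_cancel _ _
  obtain ⟨S, hS, hST⟩ := hTs.exists_inverse_of_bijective hb
  have hXc : ContDiffAt ℝ ∞ (fun z => chartField I x₀ X (pc z)) z₀ := by
    have h1 : ContDiffAt ℝ ∞ (chartField I x₀ X) (extChartAt I x₀ x₀) :=
      (contMDiffAt_iff_chartField (n := ⊤)).1 (hX x₀)
    refine ContDiffAt.comp (g := chartField I x₀ X) (f := pc) z₀ ?_ hpcs
    rw [hpc]; simp only [hback]; exact h1
  let νh : P → EK := B.equivariantMap ν.toFun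
  have hνc : ContDiffAt ℝ ∞ (fun z => νh (Ψ z)) z₀ :=
    (contMDiffAt_iff_comp_extChartAt_symm (n := ⊤)).1 (ν.contMDiff_equivariantMap y₀)
  refine (hS.clm_apply (hXc.prodMk hνc)).congr_of_eventuallyEq ?_
  filter_upwards [hST, hsrc, htgt] with z h1 h2 h3
  rw [← h1.2 (chartField J y₀ (A.liftField X ν.toFun) z)]
  refine congrArg (S z) (Prod.ext ?_ ?_)
  · refine (hpcd z h3 h2 _).trans ?_
    simp only [chartField, hpc]
    rw [(extChartAt I x₀).left_inv h2]
    refine congrArg _ ?_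
    refine Eq.trans ?_ (A.modelDeriv_proj_liftField X ν.toFun (Ψ z))
    exact congrArg _ (modelDeriv_symm_extChartAt_symm h3 _)
  · exact (A.connFormInChart_chartField _ y₀ h3).trans (A.form_liftField X ν.toFun (Ψ z))

end Connection

end PrincipalBundle

namespace PrincipalBundle

variable {EK HK : Type*} [NormedAddCommGroup EK] [NormedSpace ℝ EK]
  [TopologicalSpace HK] {IK : ModelWithCorners ℝ EK HK}
  {K : Type*} [TopologicalSpace K] [ChartedSpace HK K] [Group K] [LieGroup IK ∞ K]
  {EM HM : Type*} [NormedAddCommGroup EM] [NormedSpace ℝ EM]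
  [TopologicalSpace HM] {I : ModelWithCorners ℝ EM HM}
  {M : Type*} [TopologicalSpace M] [ChartedSpace HM M]
  {EP HP : Type*} [NormedAddCommGroup EP] [NormedSpace ℝ EP]
  [TopologicalSpace HP] {J : ModelWithCorners ℝ EP HP}
  {P : Type*} [TopologicalSpace P] [ChartedSpace HP P] [IsManifold J ∞ P]
  [MulAction Kᵐᵒᵖ P]

/-! ### The Lie derivative of the connection form -/

section DForm

variable [FiniteDimensional ℝ EP] {B : PrincipalBundle IK K I M J P} (A : B.Connection)

/-- The exterior derivative of the connection form, in terms of the model vector spaces. -/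
noncomputable def Connection.dForm (y : P) (u v : EP) : EK := A.dConnForm y u v

theorem Connection.dForm_add_left (y : P) (u u' v : EP) :
    A.dForm y (u + u') v = A.dForm y u v + A.dForm y u' v := by
  have h : ∀ u v, A.dForm y u v = fderiv ℝ (A.connFormInChart y) (extChartAt J y y)
        (modelDeriv J 𝓘(ℝ, EP) (extChartAt J y) y u) (modelDeriv J 𝓘(ℝ, EP) (extChartAt J y) y v)
      - fderiv ℝ (A.connFormInChart y) (extChartAt J y y)
        (modelDeriv J 𝓘(ℝ, EP) (extChartAt J y) y v)
        (modelDeriv J 𝓘(ℝ, EP) (extChartAt J y) y u) := fun _ _ => rfl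
  simp only [h, map_add, add_apply]
  abel

theorem Connection.dForm_add_right (y : P) (u v v' : EP) :
    A.dForm y u (v + v') = A.dForm y u v + A.dForm y u v' := by
  have h : ∀ u v, A.dForm y u v = -A.dForm y v u := fun u v => (neg_sub _ _).symm
  rw [h, A.dForm_add_left, neg_add, ← h, ← h]

end DForm

variable [J.Boundaryless] [T2Space P]

/-- For small times the local flow of the fundamental vector field of `a` is right translation by a
curve in `K`, the one-parameter group of `a`. -/
theorem exists_localFlow_fundamental [FiniteDimensional ℝ EK] [IK.Boundaryless]
    (B : PrincipalBundle IK K I M J P) (a : EK) :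
    ∃ κ : ℝ → K, ∀ᶠ t in 𝓝 (0 : ℝ), ∀ z : P,
      localFlow J (fun y : P => (modelDeriv IK J (fun k : K => y <• k) 1 a : EP)) t z
        = z <• κ t := by
  have : CompleteSpace EK := FiniteDimensional.complete ℝ EK
  have : IsManifold IK ∞ K := LieGroup.toContMDiffMul.toIsManifold
  have : IsManifold IK 1 K := IsManifold.of_le (n := ∞) (by norm_cast)
  have : LieGroup IK (minSmoothness ℝ 3) K := LieGroup.of_le (n := ∞) (by
    rw [minSmoothness_of_isRCLikeNormedField]; exact WithTop.coe_le_coe.2 (le_top : (3 : ℕ∞) ≤ ⊤))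
  have hs : ContMDiff IK IK.tangent 1 (fun g : K =>
      (⟨g, mulInvariantVectorField (I := IK) a g⟩ : TangentBundle IK K)) :=
    (contMDiff_mulInvariantVectorField (I := IK) (G := K) a).of_le (by
      rw [minSmoothness_of_isRCLikeNormedField]; norm_cast)
  obtain ⟨κ, hκ0, hκ⟩ := exists_isMIntegralCurveAt_of_contMDiffAt_boundaryless 0
    (hs (1 : K))
  obtain ⟨ε, hε, hκε⟩ := isMIntegralCurveAt_iff'.1 hκ
  rw [Real.ball_eq_Ioo, zero_sub, zero_add] at hκε
  refine ⟨κ, ?_⟩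
  filter_upwards [Ioo_mem_nhds (neg_lt_zero.2 hε) hε] with t ht z
  -- the orbit map of `z` maps the left-invariant field of `a` to the fundamental field of `a`
  have hz := hκε.map (J' := J) (Y := mulInvariantVectorField (I := IK) a) (f := fun k : K => z <• k)
    (Y' := fun y : P => (modelDeriv IK J (fun k : K => y <• k) 1 a : EP))
    (fun s _ => B.mdifferentiableAt_orbit z _) (fun s _ => B.modelDeriv_orbit (κ s) z a)
  have h := (localFlow_eq_of_isMIntegralCurveOn (B.contMDiff_fundamental a)
    ⟨neg_lt_zero.2 hε, hε⟩ ht hz).2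
  have h0 : z <• κ 0 = z := by rw [hκ0]; simp
  rwa [h0] at h

namespace Connection

variable [FiniteDimensional ℝ EP] [FiniteDimensional ℝ EK]
  {B : PrincipalBundle IK K I M J P} (A : B.Connection)

/-- Cartan's formula for the connection form: `L_Y ω = ι_Y dω + d(ω(Y))`. -/
theorem hasDerivAt_form_localFlow {Y : ∀ y : P, TangentSpace J y}
    (hY : ContMDiff J J.tangent ∞ (fun y => (⟨y, Y y⟩ : TangentBundle J P))) (y : P) (u : EP) :
    HasDerivAt (fun t => A.form (localFlow J Y t y) (modelDeriv J J (localFlow J Y t) y u))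
      (A.dForm y (Y y) u + modelDeriv J 𝓘(ℝ, EK) (fun z => A.form z (Y z)) y u) 0 := by
  have : CompleteSpace EP := FiniteDimensional.complete ℝ EP
  exact hasDerivAt_localFlow_pullback hY A.form y (ηc := A.connFormInChart y) (fun _ => rfl)
    ((A.contDiffAt_connFormInChart y).differentiableAt (by simp)) u

/-- `dω(a^#, u)` vanishes for horizontal `u`, because the flow of `a^#` preserves the horizontal
distribution and `ω(a^#)` is constant. -/
theorem dForm_fundamental_of_form_eq_zero [IK.Boundaryless] (y : P) (a : EK) {u : EP}
    (hu : A.form y u = 0) :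
    A.dForm y (modelDeriv IK J (fun k : K => y <• k) 1 a) u = 0 := by
  obtain ⟨κ, hκ⟩ := B.exists_localFlow_fundamental a
  have h := A.hasDerivAt_form_localFlow (B.contMDiff_fundamental a) y u
  have h1 : (fun z : P => A.form z (modelDeriv IK J (fun k : K => z <• k) 1 a)) = fun _ => a :=
    funext fun z => A.form_fundamental z a
  rw [h1, modelDeriv_const] at h
  refine (add_zero _).symm.trans (h.unique ?_)
  refine (hasDerivAt_const (0 : ℝ) (0 : EK)).congr_of_eventuallyEq ?_
  filter_upwards [hκ] with t ht
  rw [show localFlow J _ t = _ from funext ht, A.form_act, hu, map_zero]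

/-- `ι_Y dω` for the lift `Y = X̃ + ξ^ν` agrees with `ι_X̃ dω` on horizontal vectors. -/
theorem dForm_liftField [IK.Boundaryless] {X : ∀ x : M, TangentSpace I x} (ν : B.AdSection) (y : P)
    {u : EP} (hu : A.form y u = 0) :
    A.dForm y (A.liftField X ν.toFun y) u = A.dForm y (A.horField X y) u := by
  refine (A.dForm_add_left y (A.horField X y)
    (B.verticalField (B.equivariantMap ν.toFun) y) u).trans ?_
  exact (congrArg (A.dForm y (A.horField X y) u + ·)
    (A.dForm_fundamental_of_form_eq_zero y (B.equivariantMap ν.toFun y) hu)).trans (add_zero _)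

end Connection

end PrincipalBundle

namespace PrincipalBundle.Connection

variable {EK HK : Type*} [NormedAddCommGroup EK] [NormedSpace ℝ EK]
  [TopologicalSpace HK] {IK : ModelWithCorners ℝ EK HK}
  {K : Type*} [TopologicalSpace K] [ChartedSpace HK K] [Group K] [LieGroup IK ∞ K]
  {EM HM : Type*} [NormedAddCommGroup EM] [NormedSpace ℝ EM]
  [TopologicalSpace HM] {I : ModelWithCorners ℝ EM HM}
  {M : Type*} [TopologicalSpace M] [ChartedSpace HM M]
  {EP HP : Type*} [NormedAddCommGroup EP] [NormedSpace ℝ EP]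
  [FiniteDimensional ℝ EP] [TopologicalSpace HP] {J : ModelWithCorners ℝ EP HP}
  {P : Type*} [TopologicalSpace P] [ChartedSpace HP P] [IsManifold J ∞ P]
  [MulAction Kᵐᵒᵖ P] {B : PrincipalBundle IK K I M J P} (A : B.Connection)

/-- The Lie derivative of the connection form along `X̃ + ξ^ν`, as given by Cartan's formula. -/
noncomputable def lieForm (X : ∀ x : M, TangentSpace I x) (ν : B.AdSection) (y : P) (u : EP) : EK :=
  A.dForm y (A.liftField X ν.toFun y) u
    + modelDeriv (M₂ := EK) J 𝓘(ℝ, EK) (B.equivariantMap ν.toFun) y u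

theorem lieForm_add (X : ∀ x : M, TangentSpace I x) (ν : B.AdSection) (y : P) (u v : EP) :
    A.lieForm X ν y (u + v) = A.lieForm X ν y u + A.lieForm X ν y v := by
  exact (congrArg₂ (· + ·) (A.dForm_add_right y (A.liftField X ν.toFun y) u v)
    (map_add (modelDeriv (M₂ := EK) J 𝓘(ℝ, EK) (B.equivariantMap ν.toFun) y) u v)).trans
    (add_add_add_comm _ _ _ _)

variable [J.Boundaryless] [T2Space P] [FiniteDimensional ℝ EK] {X : ∀ x : M, TangentSpace I x}

/-! ### The moment map equation -/

/-- The moment map equation says that the Lie derivative of the connection form vanishes on the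
horizontal spaces at the chosen points of the fibres. -/
theorem generalizedMomentMapEquation_iff [IK.Boundaryless] (ν : B.AdSection) :
    A.GeneralizedMomentMapEquation X ν ↔
      ∀ (x : M) (u : EP), A.form (B.point x) u = 0 → A.lieForm X ν (B.point x) u = 0 := by
  -- the base point `x` is generalized, so that the transports along `proj y = x` disappear
  have key : ∀ (x : M) (y : P) (hy : B.proj y = x),
      (∀ v : TangentSpace I x,
        B.adMk y hy (A.dConnForm y (A.horLift y (hy.symm ▸ X x)) (A.horLift y (hy.symm ▸ v)))
          = -B.adMk y hy (mfderiv (M' := EK) J 𝓘(ℝ, EK) (B.equivariantMap ν.toFun) y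
              (A.horLift y (hy.symm ▸ v)) : EK)) ↔
      ∀ u : EP, A.form y u = 0 → A.lieForm X ν y u = 0 := by
    rintro x y rfl
    have hone : ∀ v : TangentSpace I (B.proj y),
        B.adMk y rfl (A.dConnForm y (A.horLift y (X (B.proj y))) (A.horLift y v))
          = -B.adMk y rfl (mfderiv (M' := EK) J 𝓘(ℝ, EK) (B.equivariantMap ν.toFun) y
              (A.horLift y v) : EK) ↔ A.lieForm X ν y (A.horLift y v) = 0 := by
      intro v
      have hL : A.lieForm X ν y (A.horLift y v) = A.dForm y (A.horField X y) (A.horLift y v)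
          + modelDeriv (M₂ := EK) J 𝓘(ℝ, EK) (B.equivariantMap ν.toFun) y (A.horLift y v) :=
        congrArg (· + _) (A.dForm_liftField ν y (A.form_horLift y v))
      rw [hL, add_eq_zero_iff_eq_neg]
      exact ⟨fun h => B.adMk_injective h, fun h => congrArg (B.adMk y rfl) h⟩
    refine ⟨fun h u hu => ?_, fun h v => (hone v).2 (h _ (A.form_horLift y v))⟩
    have e : A.horLift y (modelDeriv J I B.proj y u) = u :=
      A.eq_of_form_eq (A.modelDeriv_proj_horLift y _) ((A.form_horLift y _).trans hu.symm)
    exact (congrArg (A.lieForm X ν y) e).symm.trans ((hone _).1 (h _))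
  exact forall_congr' fun x => key x (B.point x) (B.proj_point x)

/-! ### Invariance under the flow of a lift -/

variable [I.Boundaryless] [IsManifold I ∞ M]

/-- The flow of `X̃ + ξ^ν` commutes with the action of the structure group. -/
theorem localFlow_liftField_act
    (hX : ContMDiff I I.tangent ∞ (fun x => (⟨x, X x⟩ : TangentBundle I M))) (ν : B.AdSection)
    {t : ℝ} {y : P} (ht : FlowDefined J (A.liftField X ν.toFun) t y) (k : K) :
    localFlow J (A.liftField X ν.toFun) t (y <• k)
      = localFlow J (A.liftField X ν.toFun) t y <• k := by
  have hY := A.contMDiff_liftField hX ν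
  obtain ⟨a, b, h0, ht', -, hγ⟩ := ht.exists_isMIntegralCurveOn hY
  have h := (localFlow_eq_of_isMIntegralCurveOn hY h0 ht'
    (hγ.map (J' := J) (f := fun z : P => z <• k) (fun s _ => B.mdifferentiableAt_act_right k _)
      (fun s _ => A.modelDeriv_act_liftField X ν.toFun k _))).2
  rwa [localFlow_zero hY] at h

theorem modelDeriv_localFlow_liftField_act
    (hX : ContMDiff I I.tangent ∞ (fun x => (⟨x, X x⟩ : TangentBundle I M))) (ν : B.AdSection)
    {t : ℝ} {y : P} (ht : FlowDefined J (A.liftField X ν.toFun) t y)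
    {k : K} (htk : FlowDefined J (A.liftField X ν.toFun) t (y <• k)) (u : EP) :
    modelDeriv J J (localFlow J (A.liftField X ν.toFun) t) (y <• k)
        (modelDeriv J J (fun z : P => z <• k) y u)
      = modelDeriv J J (fun z : P => z <• k) (localFlow J (A.liftField X ν.toFun) t y)
        (modelDeriv J J (localFlow J (A.liftField X ν.toFun) t) y u) := by
  have : CompleteSpace EP := FiniteDimensional.complete ℝ EP
  have hY := A.contMDiff_liftField hX ν
  obtain ⟨hev, hd⟩ := ht.eventually_and_mdifferentiableAt hY
  rw [← modelDeriv_comp_apply (f := fun z : P => z <• k)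
      (htk.eventually_and_mdifferentiableAt hY).2 (B.mdifferentiableAt_act_right k y),
    ← modelDeriv_comp_apply (g := fun z : P => z <• k) (B.mdifferentiableAt_act_right k _) hd]
  refine congrArg (fun T : EP →L[ℝ] EP => T u) (Filter.EventuallyEq.modelDeriv_eq ?_)
  filter_upwards [hev] with z hz using A.localFlow_liftField_act hX ν hz k

theorem modelDeriv_localFlow_liftField_fundamental
    (hX : ContMDiff I I.tangent ∞ (fun x => (⟨x, X x⟩ : TangentBundle I M))) (ν : B.AdSection)
    {t : ℝ} {y : P} (ht : FlowDefined J (A.liftField X ν.toFun) t y) (a : EK) :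
    modelDeriv J J (localFlow J (A.liftField X ν.toFun) t) y
        (modelDeriv IK J (fun k : K => y <• k) 1 a)
      = modelDeriv IK J (fun k : K => localFlow J (A.liftField X ν.toFun) t y <• k) 1 a := by
  have : CompleteSpace EP := FiniteDimensional.complete ℝ EP
  have hd := (ht.eventually_and_mdifferentiableAt (A.contMDiff_liftField hX ν)).2
  have e1 : y <• (1 : K) = y := by simp
  have h := modelDeriv_comp_apply (I₁ := IK) (I₂ := J) (I₃ := J) (x := (1 : K))
    (g := localFlow J (A.liftField X ν.toFun) t) (f := fun k : K => y <• k)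
    (by rwa [e1]) (B.mdifferentiableAt_orbit y 1) a
  rw [e1] at h
  rw [← h]
  refine congrArg (fun f : K → P => modelDeriv IK J f 1 a) ?_
  exact funext fun k => A.localFlow_liftField_act hX ν ht k

/-- Cartan's formula at any time `s` of a flow line, from the formula at time `0` at the point
`β_s(y)` and the group law `β_t = β_{t - s} ∘ β_s`. -/
theorem hasDerivAt_form_localFlow_liftField
    (hX : ContMDiff I I.tangent ∞ (fun x => (⟨x, X x⟩ : TangentBundle I M))) (ν : B.AdSection)
    {s : ℝ} {y : P} (hs : FlowDefined J (A.liftField X ν.toFun) s y) (u : EP) :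
    HasDerivAt (fun t => A.form (localFlow J (A.liftField X ν.toFun) t y)
        (modelDeriv J J (localFlow J (A.liftField X ν.toFun) t) y u))
      (A.lieForm X ν (localFlow J (A.liftField X ν.toFun) s y)
        (modelDeriv J J (localFlow J (A.liftField X ν.toFun) s) y u)) s := by
  have : CompleteSpace EP := FiniteDimensional.complete ℝ EP
  have hY := A.contMDiff_liftField hX ν
  set y' := localFlow J (A.liftField X ν.toFun) s y with hy'
  set u' := modelDeriv J J (localFlow J (A.liftField X ν.toFun) s) y u with hu'
  have h := A.hasDerivAt_form_localFlow hY y' u'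
  -- `ω(Y) = ν̂`
  have h1 : (fun z : P => A.form z (A.liftField X ν.toFun z)) = B.equivariantMap ν.toFun :=
    funext fun z => A.form_liftField X ν.toFun z
  rw [h1] at h
  rw [← sub_self s] at h
  refine (h.comp_sub_const s s).congr_of_eventuallyEq ?_
  have hev : ∀ᶠ t in 𝓝 s, FlowDefined J (A.liftField X ν.toFun) (t - s) y' := by
    have hc : Filter.Tendsto (fun t : ℝ => t - s) (𝓝 s) (𝓝 0) := by
      have : ContinuousAt (fun t : ℝ => t - s) s := by fun_prop
      simpa [ContinuousAt] using this
    exact hc.eventually (eventually_flowDefined hY y')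
  filter_upwards [hev] with t ht
  have e : s + (t - s) = t := by ring
  have h2 := modelDeriv_localFlow_add hY hs ht
  have h3 := (localFlow_add hY hs ht).2
  rw [e] at h2 h3
  rw [h2, h3]
  rfl

theorem hasDerivAt_form_localFlow_liftField_zero
    (hX : ContMDiff I I.tangent ∞ (fun x => (⟨x, X x⟩ : TangentBundle I M))) (ν : B.AdSection)
    (y : P) (u : EP) :
    HasDerivAt (fun t => A.form (localFlow J (A.liftField X ν.toFun) t y)
        (modelDeriv J J (localFlow J (A.liftField X ν.toFun) t) y u))
      (A.lieForm X ν y u) 0 := by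
  have : CompleteSpace EP := FiniteDimensional.complete ℝ EP
  have hY := A.contMDiff_liftField hX ν
  have h := A.hasDerivAt_form_localFlow_liftField hX ν (eventually_flowDefined hY y).self_of_nhds u
  rw [modelDeriv_localFlow_zero hY, localFlow_zero hY] at h
  exact h

theorem lieForm_act
    (hX : ContMDiff I I.tangent ∞ (fun x => (⟨x, X x⟩ : TangentBundle I M))) (ν : B.AdSection)
    (k : K) (y : P) (u : EP) :
    A.lieForm X ν (y <• k) (modelDeriv J J (fun z : P => z <• k) y u)
      = adjointCLM (IK := IK) k⁻¹ (A.lieForm X ν y u) := by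
  have : CompleteSpace EP := FiniteDimensional.complete ℝ EP
  have hY := A.contMDiff_liftField hX ν
  have h1 := A.hasDerivAt_form_localFlow_liftField_zero hX ν (y <• k)
    (modelDeriv J J (fun z : P => z <• k) y u)
  have h2 := (adjointCLM (IK := IK) k⁻¹).hasFDerivAt.comp_hasDerivAt (0 : ℝ)
    (A.hasDerivAt_form_localFlow_liftField_zero hX ν y u)
  refine h1.unique (h2.congr_of_eventuallyEq ?_)
  filter_upwards [eventually_flowDefined hY y, eventually_flowDefined hY (y <• k)] with t ht htk
  rw [A.modelDeriv_localFlow_liftField_act hX ν ht htk, A.localFlow_liftField_act hX ν ht]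
  exact A.form_act k _ _

/-- The Lie derivative of the connection form vanishes on vertical vectors, because the flow of
`X̃ + ξ^ν` commutes with the action and hence preserves the fundamental vector fields. -/
theorem lieForm_fundamental
    (hX : ContMDiff I I.tangent ∞ (fun x => (⟨x, X x⟩ : TangentBundle I M))) (ν : B.AdSection)
    (y : P) (a : EK) : A.lieForm X ν y (modelDeriv IK J (fun k : K => y <• k) 1 a) = 0 := by
  have : CompleteSpace EP := FiniteDimensional.complete ℝ EP
  refine (A.hasDerivAt_form_localFlow_liftField_zero hX ν y _).unique
    ((hasDerivAt_const (0 : ℝ) a).congr_of_eventuallyEq ?_)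
  filter_upwards [eventually_flowDefined (A.contMDiff_liftField hX ν) y] with t ht
  rw [A.modelDeriv_localFlow_liftField_fundamental hX ν ht]
  exact A.form_fundamental _ a

/-- If the Lie derivative of the connection form vanishes on the horizontal space at one point of
each fibre, it vanishes. -/
theorem lieForm_eq_zero
    (hX : ContMDiff I I.tangent ∞ (fun x => (⟨x, X x⟩ : TangentBundle I M))) (ν : B.AdSection)
    (h : ∀ (x : M) (u : EP), A.form (B.point x) u = 0 → A.lieForm X ν (B.point x) u = 0)
    (y : P) (u : EP) : A.lieForm X ν y u = 0 := by
  -- at the chosen points, split `u` into its horizontal and its vertical part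
  have hpt : ∀ (x : M) (u : EP), A.lieForm X ν (B.point x) u = 0 := by
    intro x u
    have hu : u = (u - modelDeriv IK J (fun k : K => B.point x <• k) 1 (A.form (B.point x) u))
        + modelDeriv IK J (fun k : K => B.point x <• k) 1 (A.form (B.point x) u) := by abel
    rw [hu, A.lieForm_add, A.lieForm_fundamental hX, add_zero]
    refine h x _ ?_
    rw [map_sub, A.form_fundamental, sub_self]
  obtain ⟨k, hk⟩ := B.exists_act_eq (B.proj_point (B.proj y)).symm
  -- `y` is the image under `k⁻¹` of the chosen point `y <• k`
  have h2 := A.lieForm_act hX ν k⁻¹ (y <• k) (modelDeriv J J (fun z : P => z <• k) y u)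
  rw [← modelDeriv_comp_apply (f := fun z : P => z <• k) (B.mdifferentiableAt_act_right _ _)
    (B.mdifferentiableAt_act_right k y)] at h2
  have e : (fun z : P => (z <• k) <• k⁻¹) = fun z => z := funext fun z => by simp
  have e' : (y <• k) <• k⁻¹ = y := congrFun e y
  rw [e, e', modelDeriv_id, ← hk, hpt, map_zero] at h2
  exact h2

theorem invariantUnderFlow_of_lieForm_eq_zero
    (hX : ContMDiff I I.tangent ∞ (fun x => (⟨x, X x⟩ : TangentBundle I M))) (ν : B.AdSection)
    (h : ∀ y u, A.lieForm X ν y u = 0) : A.InvariantUnderFlow (A.liftField X ν.toFun) := by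
  have : CompleteSpace EP := FiniteDimensional.complete ℝ EP
  have hY := A.contMDiff_liftField hX ν
  -- the pull-back of the connection form is constant along flow lines
  have hconst : ∀ (t : ℝ) (y : P) (u : EP), FlowDefined J (A.liftField X ν.toFun) t y →
      A.form (localFlow J (A.liftField X ν.toFun) t y)
        (modelDeriv J J (localFlow J (A.liftField X ν.toFun) t) y u) = A.form y u := by
    intro t y u ht
    obtain ⟨a, b, h0, ht', hab, -⟩ := ht.exists_isMIntegralCurveOn hY
    have hd : ∀ s ∈ Set.Ioo a b,
        HasDerivAt (fun t => A.form (localFlow J (A.liftField X ν.toFun) t y)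
          (modelDeriv J J (localFlow J (A.liftField X ν.toFun) t) y u)) 0 s := fun s hs => by
      have := A.hasDerivAt_form_localFlow_liftField hX ν (hab s hs) u
      rwa [h] at this
    have := isOpen_Ioo.is_const_of_deriv_eq_zero isPreconnected_Ioo
      (fun s hs => (hd s hs).differentiableAt.differentiableWithinAt)
      (fun s hs => (hd s hs).deriv) ht' h0
    rw [modelDeriv_localFlow_zero hY, localFlow_zero hY] at this
    exact this
  intro t y ht
  refine le_antisymm ?_ ?_
  · rintro _ ⟨u, hu, rfl⟩
    exact (A.form_eq_zero_iff _ _).1 ((hconst t y u ht).trans ((A.form_eq_zero_iff y u).2 hu))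
  · intro w hw
    obtain ⟨ht', hback⟩ := localFlow_neg hY ht
    -- the preimage of `w` is its image under the flow at time `-t`
    let u : EP := modelDeriv J J (localFlow J (A.liftField X ν.toFun) (-t))
      (localFlow J (A.liftField X ν.toFun) t y) w
    refine ⟨u, (A.form_eq_zero_iff y u).1 ?_, ?_⟩
    · have := hconst (-t) _ w ht'
      rw [hback] at this
      exact this.trans ((A.form_eq_zero_iff _ _).2 hw)
    · have h1 := modelDeriv_localFlow_add hY ht' (t := t) (by rwa [hback])
      rw [neg_add_cancel, modelDeriv_localFlow_zero hY, hback] at h1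
      exact (congrArg (fun T : EP →L[ℝ] EP => T w) h1).symm

theorem lieForm_eq_zero_of_invariantUnderFlow
    (hX : ContMDiff I I.tangent ∞ (fun x => (⟨x, X x⟩ : TangentBundle I M))) (ν : B.AdSection)
    (h : A.InvariantUnderFlow (A.liftField X ν.toFun)) {y : P} {u : EP} (hu : A.form y u = 0) :
    A.lieForm X ν y u = 0 := by
  have : CompleteSpace EP := FiniteDimensional.complete ℝ EP
  refine (A.hasDerivAt_form_localFlow_liftField_zero hX ν y u).unique
    ((hasDerivAt_const (0 : ℝ) (0 : EK)).congr_of_eventuallyEq ?_)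
  filter_upwards [eventually_flowDefined (A.contMDiff_liftField hX ν) y] with t ht
  refine (A.form_eq_zero_iff _ _).2 ?_
  rw [← h t y ht]
  exact Submodule.mem_map_of_mem ((A.form_eq_zero_iff y u).1 hu)

end PrincipalBundle.Connection

theorem mainTheorem1
    {EK HK : Type*} [NormedAddCommGroup EK] [NormedSpace ℝ EK] [FiniteDimensional ℝ EK]
    [TopologicalSpace HK] {IK : ModelWithCorners ℝ EK HK} [IK.Boundaryless]
    {K : Type*} [TopologicalSpace K] [ChartedSpace HK K] [Group K] [LieGroup IK ∞ K]
    {EM HM : Type*} [NormedAddCommGroup EM] [NormedSpace ℝ EM] [FiniteDimensional ℝ EM]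
    [TopologicalSpace HM] {I : ModelWithCorners ℝ EM HM} [I.Boundaryless]
    {M : Type*} [TopologicalSpace M] [ChartedSpace HM M] [IsManifold I ∞ M] [T2Space M]
    {EP HP : Type*} [NormedAddCommGroup EP] [NormedSpace ℝ EP] [FiniteDimensional ℝ EP]
    [TopologicalSpace HP] {J : ModelWithCorners ℝ EP HP} [J.Boundaryless]
    {P : Type*} [TopologicalSpace P] [ChartedSpace HP P] [IsManifold J ∞ P] [T2Space P]
    [MulAction Kᵐᵒᵖ P]
    (B : PrincipalBundle IK K I M J P) (A : B.Connection)
    (X : ∀ x : M, TangentSpace I x)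
    (hX : ContMDiff I I.tangent ∞ (fun x => (⟨x, X x⟩ : TangentBundle I M)))
    (ν : B.AdSection) :
    A.InvariantUnderFlow
        (fun y => A.horField X y + B.verticalField (B.equivariantMap ν.toFun) y) ↔
      A.GeneralizedMomentMapEquation X ν := by
  rw [A.generalizedMomentMapEquation_iff ν]
  exact ⟨fun h _ _ hu => A.lieForm_eq_zero_of_invariantUnderFlow hX ν h hu,
    fun h => A.invariantUnderFlow_of_lieForm_eq_zero hX ν (A.lieForm_eq_zero hX ν h)⟩
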